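/- For a smooth function $f:\,]0,\infty[\,\to\mathbb{R}$ consider on $\mathbb{C}\setminus\{0\}$ the differential equation $\dot z = i z f(|z|) - i$. If $p\in\mathbb{C}\setminus\{0\}$ is such that the solution $t\mapsto\Phi_f(t,p)$ with $\Phi_f(0,p)=p$ exists in $\mathbb{C}\setminus\{0\}$ for all $t\in\mathbb{R}$ and is periodic, let $T_f(p)=\inf\{t>0:\Phi_f(t,p)=p\}$ be its minimal period and define the net winding of $p$ as $$\omega_f(p)=\pm\frac1{2\pi}\int_0^{T_f(p)} f\bigl(|\Phi_f(t,p)|\bigr)\,dt ,$$ with the plus sign if the closed path $\Phi_f(\,\cdot\,,p)$ is oriented counter-clockwise and the minus sign if it is oriented clockwise (and $\omega_f(p)=0$ if $p$ is a fixed point). Let $\delta\ge\frac32$ and $f_\delta(s)=s^\delta$ for $s>0$. Then for every $0<s<1$ the solution starting at $s$ is periodic and stays in $\mathbb{C}\setminus\{0\}$, so $\omega_{f_\delta}(s)$ is defined, and the function $s\mapsto\omega_{f_\delta}(s)$ is strictly decreasing on $]0,1[$. -/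

import Mathlib

open Set MeasureTheory

noncomputable section

namespace NetWinding

/-- `γ` is the (global) solution of `z' = i z f(|z|) - i` on the punctured plane `ℂ \ {0}` with
`γ 0 = p`. For smooth `f : (0, ∞) → ℝ` there is at most one such `γ`, and there is one precisely
when the orbit of `p` under the planar flow `Φ_f` does not contain the origin; in that case
`γ t = Φ_f (t, p)` for all `t`. Only the values of `f` on `(0, ∞)` matter. -/
structure IsTrajectory (f : ℝ → ℝ) (p : ℂ) (γ : ℝ → ℂ) : Prop where
  init : γ 0 = p
  ne_zero : ∀ t, γ t ≠ 0
  hasDerivAt : ∀ t,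
    HasDerivAt γ (Complex.I * γ t * ((f ‖γ t‖ : ℝ) : ℂ) - Complex.I) t

open Classical in
/-- The trajectory `t ↦ Φ_f (t, p)` (the constant path if there is no trajectory in the punctured
plane through `p`). -/
def trajectory (f : ℝ → ℝ) (p : ℂ) : ℝ → ℂ :=
  if h : ∃ γ, IsTrajectory f p γ then h.choose else fun _ => p

/-- `p` is a periodic point of `Φ_f` (possibly a fixed point) whose orbit does not contain the
origin, that is, `p ∈ Per Φ_f \ Φ_f (ℝ, 0)`. -/
def IsPeriodicPoint (f : ℝ → ℝ) (p : ℂ) : Prop :=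
  ∃ γ, IsTrajectory f p γ ∧ ∃ t : ℝ, 0 < t ∧ γ t = p

/-- `T_f (p) = inf {t > 0 : Φ_f (t, p) = p}`, the minimal period of a periodic point `p`. -/
def minPeriod (f : ℝ → ℝ) (p : ℂ) : ℝ :=
  sInf {t : ℝ | 0 < t ∧ trajectory f p t = p}

/-- The winding number around `a` of the closed path `γ`, restricted to `[0, T]`. -/
def windingNumber (γ : ℝ → ℂ) (T : ℝ) (a : ℂ) : ℂ :=
  (2 * (Real.pi : ℂ) * Complex.I)⁻¹ * ∫ t in (0 : ℝ)..T, deriv γ t / (γ t - a)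

/-- A simple closed path (with period `T`) is oriented counter-clockwise if it has positive winding
number around the points that it encloses; around all points that it does not enclose the winding
number is zero. -/
def IsCounterclockwise (γ : ℝ → ℂ) (T : ℝ) : Prop :=
  ∃ a : ℂ, a ∉ range γ ∧ 0 < (windingNumber γ T a).re

open Classical in
/-- The sign `±1` of the orientation of a simple closed path with period `T`. -/
def orientationSign (γ : ℝ → ℂ) (T : ℝ) : ℝ :=
  if IsCounterclockwise γ T then 1 else -1

/-- The net winding `ω_f (p) = ± (2π)⁻¹ ∫_0^{T_f (p)} f(|Φ_f (t, p)|) dt` of a periodic point `p`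
whose orbit does not contain the origin, with the plus sign if the orbit is oriented
counter-clockwise and the minus sign if it is oriented clockwise (and the value `0` at fixed
points, where `T_f (p) = 0`). -/
def netWinding (f : ℝ → ℝ) (p : ℂ) : ℝ :=
  orientationSign (trajectory f p) (minPeriod f p) * (2 * Real.pi)⁻¹ *
    ∫ t in (0 : ℝ)..(minPeriod f p), f ‖trajectory f p t‖

/-- The monomial `f_δ (s) = s ^ δ`. -/
def monomial (δ : ℝ) : ℝ → ℝ := fun s => s ^ δ

end NetWinding

end

/-!
The winding is strictly decreasing because, as a function of the energy level, it is the
distribution function of a compound Poisson law read backwards.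

Write `p = δ + 2`, `a = δ + 1`. The equation preserves `H(z) = |z| ^ p / p - Re z`, whose sublevel
sets are star-shaped about the fixed point `1`, where `H = -a / p` (`radialDeriv_pos`). The orbit
of `s ∈ ]0, 1[` is therefore the level curve `H = -h` with `h = s - s ^ p / p`; this `h` increases
with `s` and runs through `]0, a / p[`. In polar coordinates `z = 1 - ρ e^{iφ}` the curve is a
graph `ρ = radius δ h φ`, the angle `φ` advances with the positive speed `angularSpeed δ h φ`, and
so every trajectory is periodic, counter-clockwise, and satisfies `∫ f dt = winding δ h`, where
`winding δ h` is an explicit integral over `φ ∈ [0, 2π]` (`exists_isTrajectory`,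
`IsTrajectory.exists_period`).

It remains to see that `W = winding δ` decreases in `h`. Passing from the coordinates `(h, φ)` to
the plane turns its moments into an integral over the region `H < 0`,

  `∫ h ^ (κ - 1) W(h) dh = ∫_{H < 0} (-H) ^ (κ - 1) |z| ^ δ dA`,

which polar coordinates about `0` reduce to beta integrals (`lintegral_winding_eq`,
`lintegral_momentDensity`). Up to elementary factors the result is `Γ(κ / a) Γ(κ) / Γ(κ m) ^ 2`,
where `m` is the midpoint of `1 / a` and `1`. By Binet's formula (`exists_Gamma_eq_binet`) it equals

  `(2π / √a) (a / p) ^ κ / κ * exp (∫₀^∞ e^{-κt} r(t) dt)`,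

with `t r(t) = β(a t) + β(t) - 2 β(t / m)` and `β(t) = 1 / (eᵗ - 1) - 1 / t + 1 / 2`. Here `r > 0`
because `c ↦ β(t / c)` is strictly convex (`jumpDensity_pos`). The last factor is the Laplace
transform of the convolution exponential `μ` of the measure `r(t) dt` on `[0, ∞[`. As moments
determine a density, `W(h) = (2π / √a) μ [0, log (a / (p h))]`, and this is strictly decreasing in
`h` because `μ` charges every interval (`strictAntiOn_of_moments`). The argument works for every
`δ > 0`.
-/

open scoped NNReal ENNReal

namespace NetWinding

/-! ### Binet's formula for the Gamma function -/

/-- The function `β(t) = 1/(eᵗ - 1) - 1/t + 1/2` in the integrand of Binet's formula. -/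
noncomputable def binetNum (t : ℝ) : ℝ := 1 / (Real.exp t - 1) - 1 / t + 1 / 2

lemma exp_sub_one_pos {t : ℝ} (ht : 0 < t) : 0 < Real.exp t - 1 := by
  have := Real.add_one_lt_exp ht.ne'
  linarith

lemma binetNum_nonneg {t : ℝ} (ht : 0 < t) : 0 ≤ binetNum t := by
  -- clearing denominators, the claim is `0 ≤ (t - 2) eᵗ + t + 2`, with equality at `t = 0`
  have hmono : StrictMonoOn (fun t : ℝ => (t - 2) * Real.exp t + t + 2) (Ici 0) := by
    apply strictMonoOn_of_deriv_pos (convex_Ici 0) (by fun_prop)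
    intro x hx
    rw [interior_Ici] at hx
    have h1 : HasDerivAt (fun t : ℝ => (t - 2) * Real.exp t + t + 2)
        (1 * Real.exp x + (x - 2) * Real.exp x + 1) x :=
      ((((hasDerivAt_id x).sub_const 2).mul
        (Real.hasDerivAt_exp x)).add (hasDerivAt_id x)).add_const 2
    rw [h1.deriv]
    have h2 := Real.add_one_lt_exp (neg_ne_zero.mpr (ne_of_gt hx))
    have h3 : Real.exp (-x) * Real.exp x = 1 := by rw [← Real.exp_add]; simp
    nlinarith [Real.exp_pos x]
  have h0 := hmono (mem_Ici.2 le_rfl) (mem_Ici.2 ht.le) ht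
  simp only [Real.exp_zero] at h0
  have he := exp_sub_one_pos ht
  have : binetNum t = ((t - 2) * Real.exp t + t + 2) / (2 * t * (Real.exp t - 1)) := by
    unfold binetNum; field_simp; ring
  rw [this]
  apply div_nonneg <;> [linarith; positivity]

lemma binetNum_le {t : ℝ} (ht : 0 < t) : binetNum t ≤ t := by
  have h1 := Real.quadratic_le_exp_of_nonneg ht.le
  have h2 : 1 / (Real.exp t - 1) ≤ 1 / (t + t ^ 2 / 2) := by
    apply one_div_le_one_div_of_le (by positivity); linarith
  have h3 : 1 / (t + t ^ 2 / 2) - 1 / t + 1 / 2 = t / (2 * (2 + t)) := by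
    field_simp; ring
  have h4 : t / (2 * (2 + t)) ≤ t := div_le_self ht.le (by linarith)
  unfold binetNum; linarith

/-- The kernel `β(t)/t` of Binet's integral. -/
noncomputable def binetKernel (t : ℝ) : ℝ := binetNum t / t

lemma binetKernel_nonneg {t : ℝ} (ht : 0 < t) : 0 ≤ binetKernel t :=
  div_nonneg (binetNum_nonneg ht) ht.le

lemma binetKernel_le {t : ℝ} (ht : 0 < t) : binetKernel t ≤ 1 :=
  (div_le_one ht).2 (binetNum_le ht)

lemma measurable_binetNum : Measurable binetNum := by
  unfold binetNum; fun_prop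

lemma measurable_binetKernel : Measurable binetKernel :=
  measurable_binetNum.div measurable_id

lemma integrableOn_exp_neg_mul {x : ℝ} (hx : 0 < x) :
    IntegrableOn (fun t => Real.exp (-(x * t))) (Ioi 0) := by
  simpa using (integrableOn_exp_mul_Ioi (a := -x) (by linarith) 0)

lemma integrableOn_binet {x : ℝ} (hx : 0 < x) :
    IntegrableOn (fun t => Real.exp (-(x * t)) * binetKernel t) (Ioi 0) := by
  refine Integrable.mono (integrableOn_exp_neg_mul hx)
    ((by fun_prop : Measurable _).mul measurable_binetKernel).aestronglyMeasurable ?_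
  filter_upwards [ae_restrict_mem measurableSet_Ioi] with t ht
  rw [norm_mul, Real.norm_of_nonneg (binetKernel_nonneg ht)]
  exact mul_le_of_le_one_right (norm_nonneg _) (binetKernel_le ht)

/-- Binet's integral `J(x) = ∫₀^∞ e^{-xt} β(t)/t dt`, the remainder in Stirling's formula. -/
noncomputable def binetIntegral (x : ℝ) : ℝ :=
  ∫ t in Ioi (0 : ℝ), Real.exp (-(x * t)) * binetKernel t

lemma convexOn_binetIntegral : ConvexOn ℝ (Ioi 0) binetIntegral := by
  refine ⟨convex_Ioi 0, fun x hx y hy a b ha hb hab => ?_⟩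
  simp only [smul_eq_mul, binetIntegral, ← integral_const_mul]
  rw [← integral_add ((integrableOn_binet hx).const_mul a) ((integrableOn_binet hy).const_mul b)]
  have hxy : 0 < a * x + b * y := (convex_Ioi (0:ℝ)) hx hy ha hb hab
  refine setIntegral_mono_on (integrableOn_binet hxy)
    (((integrableOn_binet hx).const_mul a).add ((integrableOn_binet hy).const_mul b))
    measurableSet_Ioi fun t ht => ?_
  have h := convexOn_exp.2 (mem_univ (-(x * t))) (mem_univ (-(y * t))) ha hb hab
  simp only [smul_eq_mul] at h
  have e : -((a * x + b * y) * t) = a * -(x * t) + b * -(y * t) := by ring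
  rw [e]
  calc _ ≤ (a * Real.exp (-(x * t)) + b * Real.exp (-(y * t))) * binetKernel t :=
        mul_le_mul_of_nonneg_right h (binetKernel_nonneg ht)
    _ = _ := by ring

/-- The kernel `β(t)/t`, multiplied by `1 - e^{-t}`, as the integral over `u` that occurs in the
functional equation of `J`. -/
lemma integral_half_sub_mul_exp {t : ℝ} (ht : 0 < t) :
    ∫ u in (0:ℝ)..1, (1 / 2 - u) * Real.exp (-(t * u)) = (1 - Real.exp (-t)) * binetKernel t := by
  have hd : ∀ u ∈ uIcc (0:ℝ) 1, HasDerivAt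
      (fun u => (-(1 / 2 - u) / t + 1 / t ^ 2) * Real.exp (-(t * u)))
      ((1 / 2 - u) * Real.exp (-(t * u))) u := by
    intro u _
    have h1 : HasDerivAt (fun u : ℝ => -(1 / 2 - u) / t + 1 / t ^ 2) (1 / t) u := by
      have := ((((hasDerivAt_id' u).const_sub (1/2)).neg).div_const t).add_const (1 / t ^ 2)
      rwa [neg_neg] at this
    have h2 : HasDerivAt (fun u : ℝ => Real.exp (-(t * u))) (Real.exp (-(t * u)) * (-t)) u := by
      simpa using ((hasDerivAt_id u).const_mul t).neg.exp
    refine (h1.mul h2).congr_deriv ?_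
    field_simp
    ring
  rw [intervalIntegral.integral_eq_sub_of_hasDerivAt hd
    (Continuous.intervalIntegrable (by fun_prop) _ _)]
  have he := exp_sub_one_pos ht
  have : Real.exp (-t) = 1 / Real.exp t := by rw [Real.exp_neg, one_div]
  simp only [mul_one, mul_zero, neg_zero, Real.exp_zero, this, binetKernel, binetNum]
  have := Real.exp_pos t
  field_simp
  ring

lemma integral_exp_neg_mul_Ioi {x : ℝ} (hx : 0 < x) :
    ∫ t in Ioi (0:ℝ), Real.exp (-(x * t)) = 1 / x := by
  have := integral_exp_mul_Ioi (a := -x) (by linarith) 0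
  simp only [neg_mul, mul_zero, Real.exp_zero] at this
  rw [this]; field_simp

/-- The functional equation that makes Stirling's formula with remainder `J` compatible with
`Γ(x + 1) = x Γ(x)`. -/
lemma binetIntegral_sub_add_one {x : ℝ} (hx : 0 < x) :
    binetIntegral x - binetIntegral (x + 1) =
      (x + 1 / 2) * (Real.log (x + 1) - Real.log x) - 1 := by
  -- both sides are iterated integrals of `(1/2 - u) e^{-(x + u)t}` over `t > 0` and `0 < u ≤ 1`
  have hI : Integrable (fun q : ℝ × ℝ => (1 / 2 - q.2) * Real.exp (-((x + q.2) * q.1)))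
      ((volume.restrict (Ioi 0)).prod (volume.restrict (Ioc 0 1))) := by
    have h1 : Integrable (fun q : ℝ × ℝ => Real.exp (-(x * q.1)) * (1:ℝ))
      ((volume.restrict (Ioi 0)).prod (volume.restrict (Ioc 0 1))) :=
      Integrable.mul_prod (integrableOn_exp_neg_mul hx) (integrable_const 1)
    refine h1.mono (by fun_prop) ?_
    rw [Measure.prod_restrict]
    filter_upwards [ae_restrict_mem (measurableSet_Ioi.prod measurableSet_Ioc)] with q hq
    obtain ⟨h1, h2, h3⟩ := hq
    have h1 : 0 < q.1 := h1
    rw [norm_mul, norm_mul, norm_one, mul_one, mul_comm]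
    have : ‖1 / 2 - q.2‖ ≤ 1 := by rw [Real.norm_eq_abs, abs_le]; constructor <;> linarith
    refine (mul_le_of_le_one_right (norm_nonneg _) this).trans ?_
    rw [Real.norm_of_nonneg (Real.exp_pos _).le, Real.norm_of_nonneg (Real.exp_pos _).le]
    apply Real.exp_le_exp.2
    nlinarith
  have hswap := integral_integral_swap
    (f := fun t u : ℝ => (1 / 2 - u) * Real.exp (-((x + u) * t))) hI
  have hL : ∀ t ∈ Ioi (0:ℝ), ∫ u in Ioc (0:ℝ) 1, (1 / 2 - u) * Real.exp (-((x + u) * t)) =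
      Real.exp (-(x * t)) * binetKernel t - Real.exp (-((x + 1) * t)) * binetKernel t := by
    intro t ht
    rw [← intervalIntegral.integral_of_le zero_le_one]
    have : ∀ u : ℝ, (1 / 2 - u) * Real.exp (-((x + u) * t)) =
        Real.exp (-(x * t)) * ((1 / 2 - u) * Real.exp (-(t * u))) := by
      intro u
      rw [show -((x + u) * t) = -(x * t) + -(t * u) by ring, Real.exp_add]; ring
    simp_rw [this]
    rw [intervalIntegral.integral_const_mul, integral_half_sub_mul_exp ht,
      show -((x + 1) * t) = -(x * t) + -t by ring, Real.exp_add]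
    ring
  have hR : ∀ u ∈ Ioc (0:ℝ) 1, ∫ t in Ioi (0:ℝ), (1 / 2 - u) * Real.exp (-((x + u) * t)) =
      (x + 1 / 2) * (1 / (x + u)) - 1 := by
    intro u hu
    have : 0 < x + u := by linarith [hu.1]
    rw [integral_const_mul, integral_exp_neg_mul_Ioi this]
    field_simp; ring
  rw [setIntegral_congr_fun measurableSet_Ioi hL, setIntegral_congr_fun measurableSet_Ioc hR,
    integral_sub (integrableOn_binet hx) (integrableOn_binet (by linarith)),
    ← intervalIntegral.integral_of_le zero_le_one] at hswap
  unfold binetIntegral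
  rw [hswap]
  have hd : ∀ u ∈ uIcc (0:ℝ) 1, HasDerivAt (fun u => (x + 1 / 2) * Real.log (x + u) - u)
      ((x + 1 / 2) * (1 / (x + u)) - 1) u := by
    intro u hu
    rw [uIcc_of_le zero_le_one] at hu
    have : x + u ≠ 0 := by linarith [hu.1]
    exact ((((hasDerivAt_id u).const_add x).log this).const_mul _).sub (hasDerivAt_id u)
  rw [intervalIntegral.integral_eq_sub_of_hasDerivAt hd]
  · simp; ring
  · apply ContinuousOn.intervalIntegrable
    intro u hu
    rw [uIcc_of_le zero_le_one] at hu
    have : x + u ≠ 0 := by linarith [hu.1]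
    apply ContinuousAt.continuousWithinAt
    fun_prop (disch := assumption)

/-- Binet's formula for the Gamma function, up to the value of the constant. -/
theorem exists_Gamma_eq_binet : ∃ c : ℝ, ∀ x : ℝ, 0 < x →
    Real.Gamma x = Real.exp ((x - 1 / 2) * Real.log x - x + binetIntegral x + c) := by
  refine ⟨1 - binetIntegral 1, fun x hx => ?_⟩
  refine (Real.eq_Gamma_of_log_convex
    (f := fun x =>
      Real.exp ((x - 1 / 2) * Real.log x - x + binetIntegral x + (1 - binetIntegral 1)))
    ?_ ?_ (fun _ => Real.exp_pos _) (by simp) hx).symm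
  · have h1 : ConvexOn ℝ (Ioi (0:ℝ)) fun x : ℝ => x * Real.log x :=
      Real.convexOn_mul_log.subset Ioi_subset_Ici_self (convex_Ioi 0)
    have h2 : ConvexOn ℝ (Ioi (0:ℝ)) fun x : ℝ => (1 / 2 : ℝ) • (-Real.log) x :=
      (strictConcaveOn_log_Ioi.concaveOn.neg).smul (by norm_num)
    have h3 : ConvexOn ℝ (Ioi (0:ℝ)) fun x : ℝ => -x :=
      (concaveOn_id (convex_Ioi (0:ℝ))).neg
    have h := (((h1.add h2).add h3).add convexOn_binetIntegral).add_const (1 - binetIntegral 1)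
    refine h.congr fun x _ => ?_
    simp only [Function.comp_apply, Real.log_exp, Pi.add_apply, Pi.neg_apply, smul_eq_mul]
    ring
  · intro y hy
    have h := binetIntegral_sub_add_one hy
    rw [← Real.exp_log hy, ← Real.exp_add, Real.exp_log hy]
    congr 1
    linear_combination -h

/-! ### Moments determine a density -/

/-- Finite measures on a compact interval are determined by their moments. -/
theorem measure_ext_of_moments {P Q : Measure ℝ} [IsFiniteMeasure P] [IsFiniteMeasure Q] {a b : ℝ}
    (hP : ∀ᵐ x ∂P, x ∈ Icc a b) (hQ : ∀ᵐ x ∂Q, x ∈ Icc a b)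
    (h : ∀ n : ℕ, ∫ x, x ^ n ∂P = ∫ x, x ^ n ∂Q) : P = Q := by
  have hint : ∀ (τ : Measure ℝ) [IsFiniteMeasure τ], (∀ᵐ x ∂τ, x ∈ Icc a b) →
      ∀ f : ℝ → ℝ, Continuous f → Integrable f τ := by
    intro τ _ hτ f hf
    obtain ⟨C, hC⟩ := isCompact_Icc.exists_bound_of_continuousOn (s := Icc a b) hf.continuousOn
    refine Integrable.of_bound hf.aestronglyMeasurable C ?_
    filter_upwards [hτ] with x hx using hC x hx
  have hpoly : ∀ p : Polynomial ℝ, ∫ x, p.eval x ∂P = ∫ x, p.eval x ∂Q := by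
    intro p
    simp_rw [Polynomial.eval_eq_sum_range]
    rw [integral_finsetSum _ fun i _ => hint P hP _ (by fun_prop),
      integral_finsetSum _ fun i _ => hint Q hQ _ (by fun_prop)]
    simp_rw [integral_const_mul, h]
  apply ext_of_forall_integral_eq_of_IsFiniteMeasure
  intro f
  have key : ∀ ε > 0, |∫ x, f x ∂P - ∫ x, f x ∂Q| ≤ ε * (P.real univ + Q.real univ) := by
    intro ε hε
    obtain ⟨p, hp⟩ := exists_polynomial_near_of_continuousOn a b f f.continuous.continuousOn ε hε
    have hb : ∀ (τ : Measure ℝ) [IsFiniteMeasure τ], (∀ᵐ x ∂τ, x ∈ Icc a b) →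
        |∫ x, f x ∂τ - ∫ x, p.eval x ∂τ| ≤ ε * τ.real univ := by
      intro τ _ hτ
      rw [← integral_sub (hint τ hτ _ f.continuous) (hint τ hτ _ p.continuous)]
      rw [← Real.norm_eq_abs]
      refine norm_integral_le_of_norm_le_const ?_
      filter_upwards [hτ] with x hx
      rw [Real.norm_eq_abs, abs_sub_comm]
      exact (hp x hx).le
    have h1 := hb P hP
    have h2 := hb Q hQ
    rw [hpoly p] at h1
    rw [abs_le] at *
    constructor <;> linarith
  have hle : |∫ x, f x ∂P - ∫ x, f x ∂Q| ≤ 0 := by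
    refine le_of_forall_pos_le_add fun ε hε => ?_
    set M := P.real univ + Q.real univ with hM
    have hM0 : 0 ≤ M := by positivity
    have := key (ε / (M + 1)) (by positivity)
    rw [zero_add]
    refine this.trans ?_
    rw [div_mul_eq_mul_div, div_le_iff₀ (by positivity)]
    nlinarith
  exact sub_eq_zero.1 (abs_nonpos_iff.1 hle)

/-- Two densities on a bounded interval with the same finite power moments agree almost
everywhere. -/
theorem ae_eq_of_lintegral_pow_mul_eq {b : ℝ} {F G : ℝ → ℝ≥0∞}
    (hF : AEMeasurable F (volume.restrict (Ioo 0 b)))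
    (hG : AEMeasurable G (volume.restrict (Ioo 0 b)))
    (hfin : ∫⁻ x in Ioo 0 b, F x ≠ ∞)
    (h : ∀ n : ℕ, ∫⁻ x in Ioo 0 b, ENNReal.ofReal (x ^ n) * F x =
      ∫⁻ x in Ioo 0 b, ENNReal.ofReal (x ^ n) * G x) :
    F =ᵐ[volume.restrict (Ioo 0 b)] G := by
  have hfinG : ∫⁻ x in Ioo 0 b, G x ≠ ∞ := by
    have := h 0
    simp only [pow_zero, ENNReal.ofReal_one, one_mul] at this
    rwa [← this]
  rw [← withDensity_eq_iff hF hG hfin]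
  have hsupp : ∀ F : ℝ → ℝ≥0∞, ∀ᵐ x ∂(volume.restrict (Ioo 0 b)).withDensity F, x ∈ Ioo 0 b :=
    fun F => (withDensity_absolutelyContinuous _ F) (ae_restrict_mem measurableSet_Ioo)
  have : IsFiniteMeasure ((volume.restrict (Ioo 0 b)).withDensity F) :=
    isFiniteMeasure_withDensity hfin
  have : IsFiniteMeasure ((volume.restrict (Ioo 0 b)).withDensity G) :=
    isFiniteMeasure_withDensity hfinG
  refine measure_ext_of_moments (a := 0) (b := b) ((hsupp F).mono fun _ h => Ioo_subset_Icc_self h)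
    ((hsupp G).mono fun _ h => Ioo_subset_Icc_self h) fun n => ?_
  have hm : ∀ F : ℝ → ℝ≥0∞, AEMeasurable F (volume.restrict (Ioo 0 b)) →
      ∫ x, x ^ n ∂(volume.restrict (Ioo 0 b)).withDensity F =
      (∫⁻ x in Ioo 0 b, ENNReal.ofReal (x ^ n) * F x).toReal := by
    intro F hF
    rw [integral_eq_lintegral_of_nonneg_ae _ (by fun_prop),
      lintegral_withDensity_eq_lintegral_mul₀ hF (by fun_prop)]
    · simp_rw [Pi.mul_apply, mul_comm]
    · filter_upwards [hsupp F] with x hx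
      exact pow_nonneg hx.1.le n
  rw [hm F hF, hm G hG, h n]

/-! ### Convolution exponentials of measures on the half-line -/

/-- The convolution powers of a measure on `[0, ∞)`. -/
noncomputable def convPow (ν : Measure ℝ≥0) : ℕ → Measure ℝ≥0
  | 0 => Measure.dirac 0
  | k + 1 => Measure.conv (convPow ν k) ν

/-- The convolution exponential `∑ ν^{*k} / k!`, that is, up to normalization, the compound Poisson
distribution with jump measure `ν`. -/
noncomputable def convExp (ν : Measure ℝ≥0) : Measure ℝ≥0 :=
  Measure.sum fun k : ℕ => ENNReal.ofReal ((k.factorial : ℝ)⁻¹) • convPow ν k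

instance (ν : Measure ℝ≥0) [SFinite ν] (k : ℕ) : SFinite (convPow ν k) := by
  induction k with
  | zero => unfold convPow; infer_instance
  | succ k ih => unfold convPow; infer_instance

instance (ν : Measure ℝ≥0) [SFinite ν] : SFinite (convExp ν) := by
  unfold convExp; infer_instance

/-- The Laplace transform of a measure on `[0, ∞)`. -/
noncomputable def laplace (ν : Measure ℝ≥0) (κ : ℝ) : ℝ≥0∞ :=
  ∫⁻ t, ENNReal.ofReal (Real.exp (-(κ * t))) ∂ν

lemma laplace_convPow (ν : Measure ℝ≥0) [SFinite ν] (κ : ℝ) (k : ℕ) :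
    laplace (convPow ν k) κ = laplace ν κ ^ k := by
  induction k with
  | zero => simp [laplace, convPow]
  | succ k ih =>
    have hm : Measurable fun t : ℝ≥0 => ENNReal.ofReal (Real.exp (-(κ * t))) := by fun_prop
    rw [pow_succ, ← ih]
    unfold laplace
    rw [convPow, Measure.lintegral_conv hm]
    have : ∀ x y : ℝ≥0, ENNReal.ofReal (Real.exp (-(κ * (x + y : ℝ≥0)))) =
        ENNReal.ofReal (Real.exp (-(κ * x))) * ENNReal.ofReal (Real.exp (-(κ * y))) := by
      intro x y
      rw [← ENNReal.ofReal_mul (Real.exp_pos _).le, ← Real.exp_add, NNReal.coe_add]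
      congr 2; ring
    simp_rw [this, lintegral_const_mul _ hm]
    rw [lintegral_mul_const _ hm]

lemma laplace_convExp (ν : Measure ℝ≥0) [SFinite ν] {κ x : ℝ} (hx : 0 ≤ x)
    (h : laplace ν κ = ENNReal.ofReal x) :
    laplace (convExp ν) κ = ENNReal.ofReal (Real.exp x) := by
  have h1 : laplace (convExp ν) κ =
      ∑' k : ℕ, ENNReal.ofReal ((k.factorial : ℝ)⁻¹) * laplace (convPow ν k) κ := by
    unfold laplace convExp
    rw [lintegral_sum_measure]
    simp_rw [lintegral_smul_measure, smul_eq_mul]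
  have hs : HasSum (fun n : ℕ => x ^ n / n.factorial) (Real.exp x) := by
    rw [Real.exp_eq_exp_ℝ]; exact NormedSpace.expSeries_div_hasSum_exp x
  rw [h1, ← hs.tsum_eq, ENNReal.ofReal_tsum_of_nonneg (fun n => by positivity) hs.summable]
  congr 1
  funext k
  rw [laplace_convPow, h, ← ENNReal.ofReal_pow hx, ← ENNReal.ofReal_mul (by positivity)]
  congr 1
  field_simp

/-- The linear term of the exponential series bounds the series from below. -/
lemma le_convExp (ν : Measure ℝ≥0) [SFinite ν] (s : Set ℝ≥0) (hs : MeasurableSet s) :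
    ν s ≤ convExp ν s := by
  unfold convExp
  rw [Measure.sum_apply _ hs]
  refine le_trans ?_ (ENNReal.le_tsum 1)
  simp [convPow]

/-- A density whose moments are, up to scaling, the exponential of the Laplace transform of a
positive function, is strictly decreasing: it is the distribution function of a compound Poisson
law, read in the variable `t = log (b / h)`. -/
theorem strictAntiOn_of_moments {b C : ℝ} (hb : 0 < b) (hC : 0 < C) {W ρ : ℝ → ℝ}
    (hWc : ContinuousOn W (Ioo 0 b)) (hW0 : ∀ h ∈ Ioo 0 b, 0 ≤ W h)
    (hρm : Measurable ρ) (hρ : ∀ t, 0 < t → 0 < ρ t)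
    (hρi : ∀ κ, 0 < κ → IntegrableOn (fun t => Real.exp (-(κ * t)) * ρ t) (Ioi 0))
    (hmom : ∀ κ, 0 < κ → ∫⁻ h in Ioo 0 b, ENNReal.ofReal (h ^ (κ - 1)) * ENNReal.ofReal (W h) =
      ENNReal.ofReal (C * (b ^ κ / κ) *
        Real.exp (∫ t in Ioi (0 : ℝ), Real.exp (-(κ * t)) * ρ t))) :
    StrictAntiOn W (Ioo 0 b) := by
  set ν : Measure ℝ≥0 :=
    ((volume.restrict (Ioi (0:ℝ))).withDensity fun t => ENNReal.ofReal (ρ t)).map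
      Real.toNNReal with hν
  set μ := convExp ν with hμ
  have hνL : ∀ κ, 0 < κ → laplace ν κ =
      ENNReal.ofReal (∫ t in Ioi (0 : ℝ), Real.exp (-(κ * t)) * ρ t) := by
    intro κ hκ
    unfold laplace
    rw [hν, lintegral_map (by fun_prop) (by fun_prop),
      lintegral_withDensity_eq_lintegral_mul _ (by fun_prop) (by fun_prop),
      ofReal_integral_eq_lintegral_ofReal (hρi κ hκ)]
    · refine setLIntegral_congr_fun measurableSet_Ioi fun t ht => ?_
      have ht : 0 < t := ht
      simp only [Pi.mul_apply]
      rw [← ENNReal.ofReal_mul (hρ t ht).le, Real.coe_toNNReal t ht.le, mul_comm]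
    · filter_upwards [ae_restrict_mem measurableSet_Ioi] with t ht
      exact mul_nonneg (Real.exp_pos _).le (hρ t ht).le
  have hμL : ∀ κ, 0 < κ → laplace μ κ =
      ENNReal.ofReal (Real.exp (∫ t in Ioi (0 : ℝ), Real.exp (-(κ * t)) * ρ t)) := by
    intro κ hκ
    refine laplace_convExp ν (setIntegral_nonneg measurableSet_Ioi fun t ht => ?_) (hνL κ hκ)
    exact mul_nonneg (Real.exp_pos _).le (hρ t ht).le
  -- the distribution function `h ↦ μ [0, log (b / h)]`
  set G : ℝ → ℝ≥0∞ := fun h => μ {t | h ≤ b * Real.exp (-t)} with hG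
  have hGanti : Antitone G := fun x y hxy => measure_mono fun t (ht : y ≤ _) => hxy.trans ht
  have hGfin : ∀ h, 0 < h → G h ≠ ∞ := by
    intro h hh
    refine ne_of_lt (lt_of_le_of_lt (meas_ge_le_lintegral_div (f := fun t : ℝ≥0 =>
      ENNReal.ofReal (b * Real.exp (-t))) (ε := ENNReal.ofReal h) (by fun_prop)
      (by simpa using hh) (by simp) |> le_trans (measure_mono ?_)) ?_)
    · intro t ht
      exact ENNReal.ofReal_le_ofReal ht
    · refine ENNReal.div_lt_top ?_ (by simpa using hh)
      have := hμL 1 one_pos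
      unfold laplace at this
      simp_rw [ENNReal.ofReal_mul hb.le]
      rw [lintegral_const_mul _ (by fun_prop)]
      simp only [one_mul] at this
      rw [this]
      exact ENNReal.mul_ne_top (by simp) (by simp)
  have hGstrict : ∀ x y, 0 < x → x < y → y < b → G y < G x := by
    intro x y hx hxy hyb
    have hy : 0 < y := hx.trans hxy
    have hsub : {t : ℝ≥0 | y ≤ b * Real.exp (-t)} ⊆ {t : ℝ≥0 | x ≤ b * Real.exp (-t)} :=
      fun t (ht : y ≤ _) => hxy.le.trans ht
    have hms : ∀ x, MeasurableSet {t : ℝ≥0 | x ≤ b * Real.exp (-t)} := fun x =>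
      measurableSet_le measurable_const (by fun_prop)
    have hdiff := measure_sdiff hsub (hms y).nullMeasurableSet (hGfin y hy)
    have hpos : 0 < μ ({t : ℝ≥0 | x ≤ b * Real.exp (-t)} \ {t : ℝ≥0 | y ≤ b * Real.exp (-t)}) := by
      refine lt_of_lt_of_le ?_ (le_convExp ν _ ((hms x).diff (hms y)))
      rw [hν, Measure.map_apply (by fun_prop) ((hms x).diff (hms y)),
        withDensity_apply _ (measurable_real_toNNReal ((hms x).diff (hms y))),
        Measure.restrict_restrict (measurable_real_toNNReal ((hms x).diff (hms y)))]
      have hsub2 : Ioo (Real.log (b / y)) (Real.log (b / x)) ⊆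
          Real.toNNReal ⁻¹' ({t : ℝ≥0 | x ≤ b * Real.exp (-t)} \
            {t : ℝ≥0 | y ≤ b * Real.exp (-t)}) ∩ Ioi 0 := by
        intro t ht
        have ht0 : 0 < t := (Real.log_pos (by rwa [one_lt_div hy])).trans ht.1
        have h1 := (Real.log_lt_iff_lt_exp (by positivity)).1 ht.1
        have h2 := (Real.lt_log_iff_exp_lt (by positivity)).1 ht.2
        rw [div_lt_iff₀ hy] at h1
        rw [lt_div_iff₀ hx] at h2
        refine ⟨⟨?_, ?_⟩, ht0⟩
        · simp only [mem_ofPred_eq, Real.coe_toNNReal t ht0.le, Real.exp_neg]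
          rw [← div_eq_mul_inv, le_div_iff₀ (Real.exp_pos t)]
          linarith
        · simp only [mem_ofPred_eq, Real.coe_toNNReal t ht0.le, Real.exp_neg, not_le]
          rw [← div_eq_mul_inv, div_lt_iff₀ (Real.exp_pos t)]
          linarith
      refine lt_of_lt_of_le ?_ (lintegral_mono_set hsub2)
      rw [setLIntegral_pos_iff (by fun_prop)]
      have : Function.support (fun t => ENNReal.ofReal (ρ t)) ∩
          Ioo (Real.log (b / y)) (Real.log (b / x)) =
          Ioo (Real.log (b / y)) (Real.log (b / x)) := by
        refine inter_eq_right.2 fun t ht => ?_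
        have ht0 : 0 < t := (Real.log_pos (by rwa [one_lt_div hy])).trans ht.1
        simpa using hρ t ht0
      rw [this, Real.volume_Ioo, ENNReal.ofReal_pos, sub_pos]
      exact Real.log_lt_log (by positivity) (div_lt_div_of_pos_left hb hx hxy)
    rw [hdiff] at hpos
    exact tsub_pos_iff_lt.1 hpos
  -- the moments of the distribution function
  have hGmom : ∀ κ, 0 < κ → ∫⁻ h in Ioo 0 b, ENNReal.ofReal (h ^ (κ - 1)) * G h =
      ENNReal.ofReal ((b ^ κ / κ) * Real.exp (∫ t in Ioi (0 : ℝ), Real.exp (-(κ * t)) * ρ t)) := by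
    intro κ hκ
    have hset : MeasurableSet {q : ℝ × ℝ≥0 | q.1 ≤ b * Real.exp (-q.2)} :=
      measurableSet_le (by fun_prop) (by fun_prop)
    have h1 : ∀ h : ℝ, ENNReal.ofReal (h ^ (κ - 1)) * G h =
        ∫⁻ t, {q : ℝ × ℝ≥0 | q.1 ≤ b * Real.exp (-q.2)}.indicator
        (fun q => ENNReal.ofReal (q.1 ^ (κ - 1))) (h, t) ∂μ := by
      intro h
      have hms : MeasurableSet {t : ℝ≥0 | h ≤ b * Real.exp (-t)} :=
        measurableSet_le measurable_const (by fun_prop)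
      rw [hG, ← setLIntegral_const, ← lintegral_indicator hms]
      rfl
    simp_rw [h1]
    have hmeas : Measurable ({q : ℝ × ℝ≥0 | q.1 ≤ b * Real.exp (-q.2)}.indicator
        (fun q => ENNReal.ofReal (q.1 ^ (κ - 1)))) :=
      (by fun_prop : Measurable fun q : ℝ × ℝ≥0 => ENNReal.ofReal (q.1 ^ (κ - 1))).indicator hset
    rw [lintegral_lintegral_swap (f := fun (h : ℝ) (t : ℝ≥0) =>
      {q : ℝ × ℝ≥0 | q.1 ≤ b * Real.exp (-q.2)}.indicator
        (fun q => ENNReal.ofReal (q.1 ^ (κ - 1))) (h, t)) hmeas.aemeasurable]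
    have h2 : ∀ t : ℝ≥0, ∫⁻ h in Ioo 0 b, {q : ℝ × ℝ≥0 | q.1 ≤ b * Real.exp (-q.2)}.indicator
        (fun q => ENNReal.ofReal (q.1 ^ (κ - 1))) (h, t) =
        ENNReal.ofReal (b ^ κ / κ) * ENNReal.ofReal (Real.exp (-(κ * t))) := by
      intro t
      have e0 : 0 < b * Real.exp (-t) := by positivity
      have e1 : (fun h : ℝ => {q : ℝ × ℝ≥0 | q.1 ≤ b * Real.exp (-q.2)}.indicator
        (fun q => ENNReal.ofReal (q.1 ^ (κ - 1))) (h, t)) =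
        (Iic (b * Real.exp (-t))).indicator fun h => ENNReal.ofReal (h ^ (κ - 1)) := rfl
      rw [e1, setLIntegral_indicator measurableSet_Iic]
      -- almost everywhere only: for `t = 0` the two sets differ by the point `b`
      have e2 : (Iic (b * Real.exp (-t)) ∩ Ioo 0 b : Set ℝ) =ᵐ[volume]
          Ioc 0 (b * Real.exp (-t)) := by
        have : ∀ᵐ x : ℝ, x ≠ b := by simp [ae_iff]
        filter_upwards [this] with x hx
        have hle : b * Real.exp (-t) ≤ b := mul_le_of_le_one_right hb.le (by simp)
        apply propext
        change (x ≤ _ ∧ 0 < x ∧ x < b) ↔ (0 < x ∧ x ≤ _)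
        constructor
        · rintro ⟨h1, h2, h3⟩; exact ⟨h2, h1⟩
        · rintro ⟨h1, h2⟩; exact ⟨h2, h1, lt_of_le_of_ne (h2.trans hle) hx⟩
      rw [setLIntegral_congr e2, ← ofReal_integral_eq_lintegral_ofReal,
        ← intervalIntegral.integral_of_le e0.le, integral_rpow (Or.inl (by linarith)),
        ← ENNReal.ofReal_mul (by positivity)]
      · congr 1
        rw [sub_add_cancel, Real.zero_rpow hκ.ne', Real.mul_rpow hb.le (Real.exp_pos _).le,
          ← Real.exp_mul, sub_zero]
        rw [show -(t:ℝ) * κ = -(κ * t) by ring]; ring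
      · rw [← IntegrableOn, ← intervalIntegrable_iff_integrableOn_Ioc_of_le e0.le]
        exact intervalIntegral.intervalIntegrable_rpow' (by linarith)
      · filter_upwards [ae_restrict_mem measurableSet_Ioc] with h hh
        exact Real.rpow_nonneg hh.1.le _
    simp_rw [h2]
    rw [lintegral_const_mul _ (by fun_prop), ← laplace, hμL κ hκ,
      ← ENNReal.ofReal_mul (by positivity)]
  have hae : (fun h => ENNReal.ofReal (W h)) =ᵐ[volume.restrict (Ioo 0 b)]
      fun h => ENNReal.ofReal C * G h := by
    apply ae_eq_of_lintegral_pow_mul_eq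
    · exact (hWc.aemeasurable measurableSet_Ioo).ennreal_ofReal
    · exact (hGanti.measurable.const_mul _).aemeasurable
    · have := hmom 1 one_pos
      simp only [sub_self, Real.rpow_zero, ENNReal.ofReal_one, one_mul] at this
      rw [this]; simp
    · intro n
      have e := hmom (n + 1) (by positivity)
      have e' := hGmom (n + 1) (by positivity)
      simp only [add_sub_cancel_right, Real.rpow_natCast] at e e'
      rw [e]
      simp_rw [mul_left_comm _ (ENNReal.ofReal C)]
      have hmeas : Measurable fun x : ℝ => ENNReal.ofReal (x ^ n) * G x :=
        (by fun_prop : Measurable fun x : ℝ => ENNReal.ofReal (x ^ n)).mul hGanti.measurable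
      rw [lintegral_const_mul _ hmeas, e', ← ENNReal.ofReal_mul hC.le, mul_assoc]
  -- `W` agrees almost everywhere with a strictly decreasing function, and it is continuous
  set V : ℝ → ℝ := fun h => C * (G h).toReal with hV
  have hVae : ∀ᵐ h, h ∈ Ioo 0 b → W h = V h := by
    rw [Filter.EventuallyEq, ae_restrict_iff' measurableSet_Ioo] at hae
    filter_upwards [hae] with h hh hmem
    have := congrArg ENNReal.toReal (hh hmem)
    rwa [ENNReal.toReal_ofReal (hW0 h hmem), ENNReal.toReal_mul,
      ENNReal.toReal_ofReal hC.le] at this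
  have hVstrict : ∀ x y, 0 < x → x < y → y < b → V y < V x := fun x y hx hxy hyb =>
    mul_lt_mul_of_pos_left (ENNReal.toReal_strict_mono (hGfin x hx) (hGstrict x y hx hxy hyb)) hC
  have hdense : Dense {h : ℝ | h ∈ Ioo 0 b → W h = V h} := Measure.dense_of_ae hVae
  have hcl : ∀ x ∈ Ioo 0 b, ∀ I : Set ℝ, IsOpen I → I ⊆ Ioo 0 b → x ∈ closure I → ∀ c : ℝ,
      ((∀ y ∈ I, V y ≤ c) → W x ≤ c) ∧ ((∀ y ∈ I, c ≤ V y) → c ≤ W x) := by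
    intro x hx I hI hIs hxI c
    have hx2 : x ∈ closure (I ∩ {h : ℝ | h ∈ Ioo 0 b → W h = V h}) :=
      hdense.open_subset_closure_inter hI |> fun h => (closure_minimal h isClosed_closure) hxI
    have hcw : ContinuousWithinAt W (I ∩ {h : ℝ | h ∈ Ioo 0 b → W h = V h}) x :=
      (hWc x hx).mono (inter_subset_left.trans hIs)
    have hmem := hcw.mem_closure_image hx2
    constructor
    · intro hc
      refine (isClosed_Iic (a := c)).closure_subset_iff.2 ?_ hmem
      rintro _ ⟨y, ⟨hy, hy2⟩, rfl⟩
      rw [mem_Iic, hy2 (hIs hy)]; exact hc y hy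
    · intro hc
      refine (isClosed_Ici (a := c)).closure_subset_iff.2 ?_ hmem
      rintro _ ⟨y, ⟨hy, hy2⟩, rfl⟩
      rw [mem_Ici, hy2 (hIs hy)]; exact hc y hy
  -- compare `W` at `x < y` with `V` at the two points that trisect `[x, y]`
  intro x hx y hy hxy
  have hm1 : x < (2 * x + y) / 3 := by linarith
  have hm2 : (2 * x + y) / 3 < (x + 2 * y) / 3 := by linarith
  have hm3 : (x + 2 * y) / 3 < y := by linarith
  have hx0 := hx.1
  have hyb := hy.2
  have hA := (hcl x hx (Ioo x ((2 * x + y) / 3)) isOpen_Ioo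
    (fun z hz => ⟨by linarith [hz.1], by linarith [hz.2]⟩)
    (by rw [closure_Ioo hm1.ne]; exact left_mem_Icc.2 hm1.le) (V ((2 * x + y) / 3))).2
    (fun z hz => (hVstrict z _ (by linarith [hz.1]) hz.2 (by linarith)).le)
  have hB := (hcl y hy (Ioo ((x + 2 * y) / 3) y) isOpen_Ioo
    (fun z hz => ⟨by linarith [hz.1], by linarith [hz.2]⟩)
    (by rw [closure_Ioo hm3.ne]; exact right_mem_Icc.2 hm3.le) (V ((x + 2 * y) / 3))).1
    (fun z hz => (hVstrict _ z (by linarith) hz.1 (by linarith [hz.2])).le)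
  have := hVstrict _ _ (by linarith) hm2 (by linarith)
  linarith

/-! ### Positivity of the jump density -/

lemma sinh_div_lt_sinh_div {x y : ℝ} (hx : 0 < x) (hxy : x < y) :
    Real.sinh x / x < Real.sinh y / y := by
  have hconv : StrictConvexOn ℝ (Ici (0:ℝ)) Real.sinh := by
    apply StrictMonoOn.strictConvexOn_of_deriv (convex_Ici 0) Real.continuous_sinh.continuousOn
    rw [Real.deriv_sinh, interior_Ici]
    exact Real.cosh_strictMonoOn.mono Ioi_subset_Ici_self
  have := hconv.secant_strict_mono (a := 0) (mem_Ici.2 le_rfl) (mem_Ici.2 hx.le)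
    (mem_Ici.2 (hx.trans hxy).le) hx.ne' (hx.trans hxy).ne' hxy
  simpa using this

/-- Convexity comes from the fact that the derivative in `c` is a multiple of the square of
`x / sinh x` at `x = t / (2c)`. -/
lemma strictConvexOn_one_div_exp_sub_one {t : ℝ} (ht : 0 < t) :
    StrictConvexOn ℝ (Ioi (0:ℝ)) fun c => 1 / (Real.exp (t / c) - 1) := by
  have hd : ∀ c : ℝ, 0 < c → HasDerivAt (fun c => 1 / (Real.exp (t / c) - 1))
      (1 / t * ((Real.sinh (t / (2 * c)) / (t / (2 * c)))⁻¹) ^ 2) c := by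
    intro c hc
    have he := exp_sub_one_pos (div_pos ht hc)
    have h1 : HasDerivAt (fun c : ℝ => t / c) (-t / c ^ 2) c := by
      exact ((hasDerivAt_const c t).fun_div (hasDerivAt_id' c) hc.ne').congr_deriv (by simp)
    have h2 := ((h1.exp.sub_const 1).inv he.ne')
    have h3 : HasDerivAt (fun c => 1 / (Real.exp (t / c) - 1))
        (-(Real.exp (t / c) * (-t / c ^ 2)) / (Real.exp (t / c) - 1) ^ 2) c := by
      simp only [one_div]; exact h2
    refine h3.congr_deriv ?_
    have e1 : t / c = t / (2 * c) + t / (2 * c) := by field_simp; norm_num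
    rw [e1, Real.exp_add] at he ⊢
    rw [Real.sinh_eq, Real.exp_neg]
    have hpos := Real.exp_pos (t / (2 * c))
    set E := Real.exp (t / (2 * c))
    have hE : E ^ 2 - 1 ≠ 0 := by nlinarith
    have hE' : E * E - 1 ≠ 0 := he.ne'
    have : (E - E⁻¹) / 2 = (E ^ 2 - 1) / (2 * E) := by field_simp
    rw [this]
    field_simp
  apply StrictMonoOn.strictConvexOn_of_deriv (convex_Ioi 0)
    fun c hc => (hd c hc).continuousAt.continuousWithinAt
  rw [interior_Ioi]
  intro c hc c' hc' hcc
  have hc : 0 < c := hc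
  have hc' : 0 < c' := hc'
  rw [(hd c hc).deriv, (hd c' hc').deriv]
  have hlt : t / (2 * c') < t / (2 * c) := by gcongr
  have h := sinh_div_lt_sinh_div (by positivity) hlt
  have hp : 0 < Real.sinh (t / (2 * c')) / (t / (2 * c')) :=
    div_pos (Real.sinh_pos_iff.2 (by positivity)) (by positivity)
  have hp' := hp.trans h
  gcongr

/-- The jump density of the compound Poisson law: the kernel representing
`J (κ / a) + J κ - 2 J (κ m)` for the midpoint `m` of `1 / a` and `1`. -/
noncomputable def jumpDensity (a t : ℝ) : ℝ :=
  a * binetKernel (a * t) + binetKernel t -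
    2 * (((1 + 1 / a) / 2)⁻¹ * binetKernel (((1 + 1 / a) / 2)⁻¹ * t))

lemma jumpDensity_pos {a t : ℝ} (ha : 1 < a) (ht : 0 < t) : 0 < jumpDensity a t := by
  have ha0 : 0 < a := by linarith
  have h1a : 0 < 1 / a := by positivity
  have hne : 1 / a ≠ 1 := by rw [ne_eq, div_eq_one_iff_eq ha0.ne']; exact ha.ne
  have h := (strictConvexOn_one_div_exp_sub_one ht).2 h1a (mem_Ioi.2 one_pos) hne
    (half_pos one_pos) (half_pos one_pos) (by norm_num)
  simp only [smul_eq_mul] at h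
  rw [show (1 / 2 : ℝ) * (1 / a) + 1 / 2 * 1 = (1 + 1 / a) / 2 by ring] at h
  have hm : 0 < (1 + 1 / a) / 2 := by positivity
  have hma : (1 + 1 / a) / 2 * 2 * a = a + 1 := by field_simp
  unfold jumpDensity
  generalize (1 + 1 / a) / 2 = m at *
  have e1 : m⁻¹ * t = t / m := by field_simp
  have e2 : t / (1 / a) = a * t := by field_simp
  rw [e2, div_one] at h
  have key : t * (a * binetKernel (a * t) + binetKernel t - 2 * (m⁻¹ * binetKernel (m⁻¹ * t))) =
      1 / (Real.exp (a * t) - 1) + 1 / (Real.exp t - 1) - 2 * (1 / (Real.exp (t / m) - 1)) := by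
    rw [e1]
    unfold binetKernel binetNum
    set A := 1 / (Real.exp (a * t) - 1)
    set B := 1 / (Real.exp t - 1)
    set C := 1 / (Real.exp (t / m) - 1)
    field_simp
    linear_combination 2 * hma
  refine (pos_iff_pos_of_mul_pos (a := t) ?_).1 ht
  rw [key]; linarith

lemma measurable_jumpDensity (a : ℝ) : Measurable (jumpDensity a) := by
  have := measurable_binetKernel
  unfold jumpDensity; fun_prop

lemma integrableOn_binet_scale {c κ : ℝ} (hc : 0 < c) (hκ : 0 < κ) :
    IntegrableOn (fun t => Real.exp (-(κ * t)) * (c * binetKernel (c * t))) (Ioi 0) := by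
  have h := integrableOn_binet (div_pos hκ hc)
  have h2 := (integrableOn_Ioi_comp_mul_left_iff
    (fun t => Real.exp (-(κ / c * t)) * binetKernel t) 0 hc).2 (by simpa using h)
  refine IntegrableOn.congr_fun (h2.const_mul c) (fun t _ => ?_) measurableSet_Ioi
  change c * _ = _
  rw [show κ / c * (c * t) = κ * t by field_simp]; ring

lemma integral_binet_scale {c κ : ℝ} (hc : 0 < c) :
    ∫ t in Ioi (0 : ℝ), Real.exp (-(κ * t)) * (c * binetKernel (c * t)) =
      binetIntegral (κ / c) := by
  have h := integral_comp_mul_left_Ioi (fun t => Real.exp (-(κ / c * t)) * binetKernel t) 0 hc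
  rw [mul_zero, ← binetIntegral] at h
  have h2 : binetIntegral (κ / c) = c * (c⁻¹ • binetIntegral (κ / c)) := by
    rw [smul_eq_mul]; field_simp
  rw [h2, ← h, ← integral_const_mul]
  congr 1
  funext t
  rw [show κ / c * (c * t) = κ * t by field_simp]; ring

lemma integrableOn_jumpDensity {a κ : ℝ} (ha : 0 < a) (hκ : 0 < κ) :
    IntegrableOn (fun t => Real.exp (-(κ * t)) * jumpDensity a t) (Ioi 0) := by
  have hm : 0 < ((1 + 1 / a) / 2)⁻¹ := by positivity
  have h := ((integrableOn_binet_scale ha hκ).add (integrableOn_binet hκ)).sub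
    ((integrableOn_binet_scale hm hκ).const_mul 2)
  refine h.congr_fun (fun t _ => ?_) measurableSet_Ioi
  simp only [Pi.add_apply, Pi.sub_apply, jumpDensity]
  ring

lemma integral_jumpDensity {a κ : ℝ} (ha : 0 < a) (hκ : 0 < κ) :
    ∫ t in Ioi (0 : ℝ), Real.exp (-(κ * t)) * jumpDensity a t =
      binetIntegral (κ / a) + binetIntegral κ - 2 * binetIntegral (κ * ((1 + 1 / a) / 2)) := by
  have hm : 0 < ((1 + 1 / a) / 2)⁻¹ := by positivity
  have e : ∀ t, Real.exp (-(κ * t)) * jumpDensity a t =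
      (Real.exp (-(κ * t)) * (a * binetKernel (a * t)) + Real.exp (-(κ * t)) * binetKernel t) -
      2 * (Real.exp (-(κ * t)) *
        (((1 + 1 / a) / 2)⁻¹ * binetKernel (((1 + 1 / a) / 2)⁻¹ * t))) := by
    intro t; unfold jumpDensity; ring
  simp_rw [e]
  have i1 := integrableOn_binet_scale ha hκ
  have i2 := integrableOn_binet hκ
  have i3 := integrableOn_binet_scale hm hκ
  have i12 : IntegrableOn (fun t => Real.exp (-(κ * t)) * (a * binetKernel (a * t)) +
      Real.exp (-(κ * t)) * binetKernel t) (Ioi 0) := i1.add i2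
  rw [integral_sub i12 (i3.const_mul 2), integral_add i1 i2, integral_const_mul,
    integral_binet_scale ha, integral_binet_scale hm, div_inv_eq_mul]
  rfl

/-- The quotient of Gamma values that computes the moments of the winding, in exponential form. -/
lemma Gamma_quotient {a κ : ℝ} (ha : 0 < a) (hκ : 0 < κ) :
    (a + 1) ^ (κ / a) * 4 ^ (-(κ * ((1 + 1 / a) / 2))) *
      (Real.Gamma (κ / a) * Real.Gamma κ / Real.Gamma (κ * ((1 + 1 / a) / 2)) ^ 2) =
    √a * ((1 + 1 / a) / 2) * (a / (a + 1)) ^ κ *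
      Real.exp (∫ t in Ioi (0 : ℝ), Real.exp (-(κ * t)) * jumpDensity a t) := by
  obtain ⟨c, hc⟩ := exists_Gamma_eq_binet
  have hm : 0 < (1 + 1 / a) / 2 := by positivity
  have hlm : Real.log ((1 + 1 / a) / 2) = Real.log (a + 1) - Real.log a - Real.log 2 := by
    rw [show (1 + 1 / a) / 2 = (a + 1) / a / 2 by field_simp,
      Real.log_div (by positivity) two_ne_zero, Real.log_div (by positivity) ha.ne']
  have h4 : Real.log 4 = 2 * Real.log 2 := by
    rw [show (4:ℝ) = 2 ^ 2 by norm_num, Real.log_pow]; norm_num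
  have hsm : √a * ((1 + 1 / a) / 2) =
      Real.exp (Real.log a * (1 / 2) + (Real.log (a + 1) - Real.log a - Real.log 2)) := by
    rw [← hlm, Real.exp_add, Real.exp_log hm, Real.sqrt_eq_rpow, Real.rpow_def_of_pos ha]
  rw [integral_jumpDensity ha hκ, hc _ (div_pos hκ ha), hc _ hκ, hc _ (mul_pos hκ hm),
    Real.rpow_def_of_pos (by positivity), Real.rpow_def_of_pos (by norm_num),
    Real.rpow_def_of_pos (by positivity), Real.log_div (by positivity) (by positivity),
    Real.log_div (by positivity) (by positivity), Real.log_mul (by positivity) (by positivity), h4,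
    hsm, hlm]
  rw [← Real.exp_nat_mul, ← Real.exp_add, ← Real.exp_add, ← Real.exp_add, ← Real.exp_sub,
    ← Real.exp_add, ← Real.exp_add]
  congr 1
  push_cast
  field_simp
  ring

/-! ### Level curves of the first integral -/

/-- `|1 - ρ e^{iφ}|²`, where `(ρ, φ)` are polar coordinates about the fixed point `1`. -/
noncomputable def distSq (ρ φ : ℝ) : ℝ := 1 - 2 * ρ * Real.cos φ + ρ ^ 2

/-- The value of `f_δ` at `|1 - ρ e^{iφ}|`. -/
noncomputable def freq (δ ρ φ : ℝ) : ℝ := distSq ρ φ ^ (δ / 2)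

/-- The first integral `|z| ^ (δ + 2) / (δ + 2) - Re z` at `z = 1 - ρ e^{iφ}`. -/
noncomputable def energy (δ ρ φ : ℝ) : ℝ :=
  distSq ρ φ ^ (δ / 2 + 1) / (δ + 2) - 1 + ρ * Real.cos φ

/-- The radial derivative of the first integral. -/
noncomputable def radialDeriv (δ ρ φ : ℝ) : ℝ :=
  freq δ ρ φ * (ρ - Real.cos φ) + Real.cos φ

/-- Minus the value of the first integral at the fixed point `1`. -/
noncomputable def depth (δ : ℝ) : ℝ := (δ + 1) / (δ + 2)

lemma distSq_nonneg (ρ φ : ℝ) : 0 ≤ distSq ρ φ := by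
  have : distSq ρ φ = (ρ - Real.cos φ) ^ 2 + Real.sin φ ^ 2 := by
    unfold distSq; linear_combination -Real.sin_sq_add_cos_sq φ
  rw [this]; positivity

lemma freq_nonneg (δ ρ φ : ℝ) : 0 ≤ freq δ ρ φ := Real.rpow_nonneg (distSq_nonneg ρ φ) _

/-- The level curves of the first integral are star-shaped about the fixed point. -/
lemma radialDeriv_pos {δ : ℝ} (hδ : 0 < δ) {ρ : ℝ} (hρ : 0 < ρ) (φ : ℝ) :
    0 < radialDeriv δ ρ φ := by
  have hN := distSq_nonneg ρ φ
  have hF := freq_nonneg δ ρ φ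
  -- `freq` is a positive power of `distSq`, so both lie on the same side of `1`
  have h1 : 0 ≤ (1 - freq δ ρ φ) * (1 - distSq ρ φ) := by
    rcases le_total (distSq ρ φ) 1 with h | h
    · have : freq δ ρ φ ≤ 1 := Real.rpow_le_one hN h (by linarith)
      exact mul_nonneg (by linarith) (by linarith)
    · have : 1 ≤ freq δ ρ φ := Real.one_le_rpow h (by linarith)
      exact mul_nonneg_of_nonpos_of_nonpos (by linarith) (by linarith)
  have h2 : ρ * radialDeriv δ ρ φ =
      ((1 + freq δ ρ φ) * ρ ^ 2 + (1 - freq δ ρ φ) * (1 - distSq ρ φ)) / 2 := by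
    unfold radialDeriv distSq; ring
  have h3 : 0 < ρ * radialDeriv δ ρ φ := by
    rw [h2]; positivity
  exact (pos_iff_pos_of_mul_pos h3).1 hρ

lemma energy_zero {δ : ℝ} (hδ : 0 < δ) (φ : ℝ) : energy δ 0 φ = -depth δ := by
  simp only [energy, distSq, depth]
  norm_num
  field_simp; ring

lemma hasFDerivAt_energy {δ : ℝ} (hδ : 0 < δ) (ρ φ : ℝ) :
    HasFDerivAt (fun q : ℝ × ℝ => energy δ q.1 q.2)
      (radialDeriv δ ρ φ • ContinuousLinearMap.fst ℝ ℝ ℝ +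
        (-(ρ * (1 - freq δ ρ φ) * Real.sin φ)) • ContinuousLinearMap.snd ℝ ℝ ℝ) (ρ, φ) := by
  have h1 : HasFDerivAt (fun q : ℝ × ℝ => q.1) (ContinuousLinearMap.fst ℝ ℝ ℝ) (ρ, φ) :=
    hasFDerivAt_fst
  have h2 : HasFDerivAt (fun q : ℝ × ℝ => q.2) (ContinuousLinearMap.snd ℝ ℝ ℝ) (ρ, φ) :=
    hasFDerivAt_snd
  have hc := h2.cos
  have hN : HasFDerivAt (fun q : ℝ × ℝ => distSq q.1 q.2) _ (ρ, φ) :=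
    (((h1.const_mul 2).mul hc).const_sub 1).add (h1.pow 2)
  have hp := hN.rpow_const (p := δ / 2 + 1) (Or.inr (by linarith))
  have := ((hp.mul_const (δ + 2)⁻¹).sub_const 1).add (h1.mul hc)
  refine this.congr_fderiv ?_
  ext <;> simp [radialDeriv, freq] <;> field_simp <;> ring

lemma hasDerivAt_energy {δ : ℝ} (hδ : 0 < δ) (ρ φ : ℝ) :
    HasDerivAt (fun ρ => energy δ ρ φ) (radialDeriv δ ρ φ) ρ := by
  have h := (hasFDerivAt_energy hδ ρ φ).comp_hasDerivAt ρ
    ((hasDerivAt_id ρ).prodMk (hasDerivAt_const ρ φ))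
  exact h.congr_deriv (by simp)

lemma continuous_energy {δ : ℝ} (hδ : 0 < δ) : Continuous fun q : ℝ × ℝ => energy δ q.1 q.2 :=
  continuous_iff_continuousAt.2 fun q => (hasFDerivAt_energy hδ q.1 q.2).continuousAt

lemma strictMonoOn_energy {δ : ℝ} (hδ : 0 < δ) (φ : ℝ) :
    StrictMonoOn (fun ρ => energy δ ρ φ) (Ici 0) := by
  apply strictMonoOn_of_deriv_pos (convex_Ici 0)
    ((continuous_energy hδ).comp (Continuous.prodMk_left φ)).continuousOn
  intro ρ hρ
  rw [interior_Ici] at hρ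
  change 0 < deriv (fun ρ => energy δ ρ φ) ρ
  rw [(hasDerivAt_energy hδ ρ φ).deriv]
  exact radialDeriv_pos hδ hρ φ

lemma exists_energy_nonneg {δ : ℝ} (hδ : 0 < δ) (φ : ℝ) : ∃ ρ, 0 < ρ ∧ 0 ≤ energy δ ρ φ := by
  -- with `X = 2 (δ + 2)` and `ρ = 1 + X`, the term `X ^ 2 / (δ + 2) = 2 X` beats `1 + ρ = 2 + X`
  refine ⟨1 + 2 * (δ + 2), by linarith, ?_⟩
  set X := 2 * (δ + 2) with hX
  have hc := Real.cos_le_one φ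
  have hc' := Real.neg_one_le_cos φ
  have hN : X ^ 2 ≤ distSq (1 + X) φ := by
    unfold distSq; nlinarith
  have h1 : X ^ 2 ≤ distSq (1 + X) φ ^ (δ / 2 + 1) := by
    refine hN.trans (Real.self_le_rpow_of_one_le ?_ (by linarith))
    nlinarith
  have h2 : X ^ 2 / (δ + 2) = 2 * X := by rw [hX]; field_simp
  have h3 : X ^ 2 / (δ + 2) ≤ distSq (1 + X) φ ^ (δ / 2 + 1) / (δ + 2) := by gcongr
  unfold energy
  nlinarith

lemma exists_energy_eq {δ : ℝ} (hδ : 0 < δ) {h : ℝ} (h0 : 0 < h) (h1 : h < depth δ) (φ : ℝ) :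
    ∃ ρ, 0 < ρ ∧ energy δ ρ φ = -h := by
  obtain ⟨M, hM, hM2⟩ := exists_energy_nonneg hδ φ
  have := intermediate_value_Ioo hM.le (f := fun ρ => energy δ ρ φ)
    ((continuous_energy hδ).comp (Continuous.prodMk_left φ)).continuousOn
  obtain ⟨ρ, hρ, he⟩ := this (show -h ∈ _ from ⟨by rw [energy_zero hδ]; linarith, by linarith⟩)
  exact ⟨ρ, hρ.1, he⟩

open Classical in
/-- The level curve of the first integral at the level `-h`, as a polar graph about the fixed
point `1`. It takes the value `1` when no point of the ray lies on that level. -/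
noncomputable def radius (δ h φ : ℝ) : ℝ :=
  if hex : ∃ ρ, 0 < ρ ∧ energy δ ρ φ = -h then hex.choose else 1

lemma radius_pos (δ h φ : ℝ) : 0 < radius δ h φ := by
  unfold radius
  split_ifs with hex
  exacts [hex.choose_spec.1, one_pos]

lemma energy_radius {δ : ℝ} (hδ : 0 < δ) {h : ℝ} (hh : h ∈ Ioo 0 (depth δ)) (φ : ℝ) :
    energy δ (radius δ h φ) φ = -h := by
  have hex := exists_energy_eq hδ hh.1 hh.2 φ
  unfold radius
  rw [dif_pos hex]
  exact hex.choose_spec.2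

lemma radius_eq {δ : ℝ} (hδ : 0 < δ) {h ρ φ : ℝ} (hh : h ∈ Ioo 0 (depth δ)) (hρ : 0 < ρ)
    (he : energy δ ρ φ = -h) : radius δ h φ = ρ :=
  (strictMonoOn_energy hδ φ).injOn (radius_pos δ h φ).le hρ.le
    ((energy_radius hδ hh φ).trans he.symm)

lemma radius_add_two_pi (δ h φ : ℝ) : radius δ h (φ + 2 * Real.pi) = radius δ h φ := by
  have e : (fun ρ => energy δ ρ (φ + 2 * Real.pi)) = fun ρ => energy δ ρ φ := by
    simp only [energy, distSq, Real.cos_add_two_pi]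
  classical
  exact congrArg (fun E : ℝ → ℝ => if hex : ∃ ρ, 0 < ρ ∧ E ρ = -h then hex.choose else 1) e

/-- Continuity of the level curves holds since `a < radius δ h φ` and `radius δ h φ < a` amount to
strict inequalities between `energy δ a φ` and `-h`. -/
lemma continuousOn_radius {δ : ℝ} (hδ : 0 < δ) :
    ContinuousOn (fun q : ℝ × ℝ => radius δ q.1 q.2) (Ioo 0 (depth δ) ×ˢ univ) := by
  have ho : IsOpen (Ioo 0 (depth δ) ×ˢ (univ : Set ℝ)) := isOpen_Ioo.prod isOpen_univ
  rintro ⟨h, φ⟩ hq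
  apply ContinuousAt.continuousWithinAt
  have hcont : ∀ a : ℝ, Continuous fun q : ℝ × ℝ => energy δ a q.2 + q.1 := fun a =>
    ((continuous_energy hδ).comp (continuous_const.prodMk continuous_snd)).add continuous_fst
  refine tendsto_order.2 ⟨fun a ha => ?_, fun a ha => ?_⟩
  · rcases le_or_gt a 0 with h0 | h0
    · exact Filter.Eventually.of_forall fun q => h0.trans_lt (radius_pos _ _ _)
    · have h1 : energy δ a φ + h < 0 := by
        have := strictMonoOn_energy hδ φ h0.le (radius_pos δ h φ).le ha
        simp only [energy_radius hδ hq.1] at this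
        linarith
      filter_upwards [ho.mem_nhds hq,
        (hcont a).continuousAt.eventually_lt continuousAt_const h1] with q hq hlt
      rw [← (strictMonoOn_energy hδ q.2).lt_iff_lt h0.le (radius_pos δ q.1 q.2).le]
      simp only [energy_radius hδ hq.1]
      linarith
  · have h0 : 0 < a := (radius_pos _ _ _).trans ha
    have h1 : 0 < energy δ a φ + h := by
      have := strictMonoOn_energy hδ φ (radius_pos δ h φ).le h0.le ha
      simp only [energy_radius hδ hq.1] at this
      linarith
    filter_upwards [ho.mem_nhds hq,
      continuousAt_const.eventually_lt (hcont a).continuousAt h1] with q hq hlt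
    rw [← (strictMonoOn_energy hδ q.2).lt_iff_lt (radius_pos δ q.1 q.2).le h0.le]
    simp only [energy_radius hδ hq.1]
    linarith

/-- `(h, φ) ↦ (radius δ h φ, φ)` is a continuous inverse of `(ρ, φ) ↦ (-energy δ ρ φ, φ)`, whose
derivative is invertible. -/
lemma hasDerivAt_radius {δ : ℝ} (hδ : 0 < δ) {h : ℝ} (hh : h ∈ Ioo 0 (depth δ)) (φ : ℝ) :
    HasDerivAt (radius δ h) (radius δ h φ * (1 - freq δ (radius δ h φ) φ) * Real.sin φ /
      radialDeriv δ (radius δ h φ) φ) φ := by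
  set r := radius δ h φ with hr
  have ha : radialDeriv δ r φ ≠ 0 := (radialDeriv_pos hδ (radius_pos δ h φ) φ).ne'
  set a := radialDeriv δ r φ
  set b := -(r * (1 - freq δ r φ) * Real.sin φ) with hb
  let L : (ℝ × ℝ) ≃L[ℝ] (ℝ × ℝ) := ContinuousLinearEquiv.equivOfInverse
    ((a • ContinuousLinearMap.fst ℝ ℝ ℝ + b • ContinuousLinearMap.snd ℝ ℝ ℝ).prod
      (ContinuousLinearMap.snd ℝ ℝ ℝ))
    ((a⁻¹ • (ContinuousLinearMap.fst ℝ ℝ ℝ - b • ContinuousLinearMap.snd ℝ ℝ ℝ)).prod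
      (ContinuousLinearMap.snd ℝ ℝ ℝ))
    (fun q => by ext <;> simp [ha])
    (fun q => by ext <;> simp [ha])
  have hcont : ContinuousAt (fun q : ℝ × ℝ => (radius δ (-q.1) q.2, q.2)) (-h, φ) := by
    refine ContinuousAt.prodMk ?_ continuousAt_snd
    have h1 : ContinuousAt (fun q : ℝ × ℝ => radius δ q.1 q.2) (h, φ) :=
      (continuousOn_radius hδ).continuousAt
        ((isOpen_Ioo.prod isOpen_univ).mem_nhds ⟨hh, mem_univ _⟩)
    have h2 : ContinuousAt (fun q : ℝ × ℝ => (-q.1, q.2)) (-h, φ) := by fun_prop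
    refine ContinuousAt.comp (g := fun q : ℝ × ℝ => radius δ q.1 q.2) ?_ h2
    simpa using h1
  have hfd : HasFDerivAt (fun q : ℝ × ℝ => (energy δ q.1 q.2, q.2)) (L : (ℝ × ℝ) →L[ℝ] (ℝ × ℝ))
      ((fun q : ℝ × ℝ => (radius δ (-q.1) q.2, q.2)) (-h, φ)) := by
    simp only [neg_neg]
    exact (hasFDerivAt_energy hδ _ φ).prodMk hasFDerivAt_snd
  have hinv : ∀ᶠ q in nhds ((-h, φ) : ℝ × ℝ),
      (fun q : ℝ × ℝ => (energy δ q.1 q.2, q.2)) (radius δ (-q.1) q.2, q.2) = q := by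
    have : ∀ᶠ q in nhds ((-h, φ) : ℝ × ℝ), -q.1 ∈ Ioo 0 (depth δ) :=
      (continuous_fst.neg.continuousAt (x := ((-h, φ) : ℝ × ℝ))).eventually_mem
        (isOpen_Ioo.mem_nhds (by simpa using hh))
    filter_upwards [this] with q hq
    ext
    · simp [energy_radius hδ hq]
    · rfl
  have hmain := (HasFDerivAt.of_local_left_inverse hcont hfd hinv)
  have hline : HasDerivAt (fun φ : ℝ => ((-h, φ) : ℝ × ℝ)) (0, 1) φ :=
    (hasDerivAt_const φ (-h)).prodMk (hasDerivAt_id φ)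
  have h3 := (hasFDerivAt_fst.comp _ hmain).comp_hasDerivAt φ hline
  simp only [Function.comp_def, neg_neg] at h3
  refine h3.congr_deriv ?_
  simp only [L, ContinuousLinearMap.comp_apply]
  change a⁻¹ * (0 - b * 1) = _
  rw [hb]; field_simp; ring

/-! ### Angular speed and winding of a level curve -/

/-- The angular speed about the fixed point along the level curve `-h`. -/
noncomputable def angularSpeed (δ h φ : ℝ) : ℝ :=
  radialDeriv δ (radius δ h φ) φ / radius δ h φ

lemma angularSpeed_pos {δ : ℝ} (hδ : 0 < δ) (h φ : ℝ) : 0 < angularSpeed δ h φ :=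
  div_pos (radialDeriv_pos hδ (radius_pos _ _ _) φ) (radius_pos _ _ _)

lemma angularSpeed_add_two_pi (δ h φ : ℝ) :
    angularSpeed δ h (φ + 2 * Real.pi) = angularSpeed δ h φ := by
  simp only [angularSpeed, radius_add_two_pi, radialDeriv, freq, distSq, Real.cos_add_two_pi]

lemma continuous_freq {δ : ℝ} (hδ : 0 < δ) : Continuous fun q : ℝ × ℝ => freq δ q.1 q.2 := by
  unfold freq distSq
  exact Continuous.rpow_const (by fun_prop) fun _ => Or.inr (by linarith)

lemma continuousOn_freq_radius {δ : ℝ} (hδ : 0 < δ) :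
    ContinuousOn (fun q : ℝ × ℝ => freq δ (radius δ q.1 q.2) q.2) (Ioo 0 (depth δ) ×ˢ univ) :=
  (continuous_freq hδ).comp_continuousOn (f := fun q : ℝ × ℝ => (radius δ q.1 q.2, q.2))
    ((continuousOn_radius hδ).prodMk continuousOn_snd)

lemma continuousOn_angularSpeed {δ : ℝ} (hδ : 0 < δ) :
    ContinuousOn (fun q : ℝ × ℝ => angularSpeed δ q.1 q.2) (Ioo 0 (depth δ) ×ˢ univ) := by
  have h1 := continuousOn_radius hδ
  have h2 : ContinuousOn (fun q : ℝ × ℝ => Real.cos q.2) (Ioo 0 (depth δ) ×ˢ univ) := by fun_prop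
  exact ((((continuousOn_freq_radius hδ).mul (h1.sub h2)).add h2)).div h1 fun q _ =>
    (radius_pos _ _ _).ne'

/-- The integral of `f_δ` over one revolution along the level curve `-h`, the time being expressed
by the angle about the fixed point. -/
noncomputable def winding (δ h : ℝ) : ℝ :=
  ∫ φ in (0 : ℝ)..(2 * Real.pi), freq δ (radius δ h φ) φ / angularSpeed δ h φ

lemma continuousOn_windingDensity {δ : ℝ} (hδ : 0 < δ) :
    ContinuousOn (fun q : ℝ × ℝ => freq δ (radius δ q.1 q.2) q.2 / angularSpeed δ q.1 q.2)
      (Ioo 0 (depth δ) ×ˢ univ) :=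
  (continuousOn_freq_radius hδ).div (continuousOn_angularSpeed hδ) fun _ _ =>
    (angularSpeed_pos hδ _ _).ne'

lemma continuousOn_winding {δ : ℝ} (hδ : 0 < δ) : ContinuousOn (winding δ) (Ioo 0 (depth δ)) := by
  rw [continuousOn_iff_continuous_domRestrict]
  refine intervalIntegral.continuous_parametric_intervalIntegral_of_continuous'
    (X := Ioo 0 (depth δ))
    (f := fun h φ => freq δ (radius δ h φ) φ / angularSpeed δ h φ) ?_ 0 (2 * Real.pi)
  exact (continuousOn_windingDensity hδ).comp_continuous
    (f := fun q : Ioo 0 (depth δ) × ℝ => ((q.1 : ℝ), q.2)) (by fun_prop)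
    fun q => ⟨q.1.2, mem_univ _⟩

lemma continuous_angularSpeed {δ : ℝ} (hδ : 0 < δ) {h : ℝ} (hh : h ∈ Ioo 0 (depth δ)) :
    Continuous (angularSpeed δ h) :=
  (continuousOn_angularSpeed hδ).comp_continuous (f := fun φ : ℝ => (h, φ)) (by fun_prop)
    fun _ => ⟨hh, mem_univ _⟩

lemma continuous_windingDensity {δ : ℝ} (hδ : 0 < δ) {h : ℝ} (hh : h ∈ Ioo 0 (depth δ)) :
    Continuous fun φ => freq δ (radius δ h φ) φ / angularSpeed δ h φ :=
  (continuousOn_windingDensity hδ).comp_continuous (f := fun φ : ℝ => (h, φ)) (by fun_prop)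
    fun _ => ⟨hh, mem_univ _⟩

/-! ### Beta integrals -/

lemma lintegral_beta {α β : ℝ} (hα : 0 < α) (hβ : 0 < β) :
    ∫⁻ x in Ioo (0:ℝ) 1, ENNReal.ofReal (x ^ (α - 1) * (1 - x) ^ (β - 1)) =
      ENNReal.ofReal (ProbabilityTheory.beta α β) := by
  have hb := ProbabilityTheory.beta_pos hα hβ
  have h := ProbabilityTheory.lintegral_betaPDF_eq_one hα hβ
  rw [ProbabilityTheory.lintegral_betaPDF] at h
  have h2 : ∫⁻ x in Ioo (0:ℝ) 1, ENNReal.ofReal (x ^ (α - 1) * (1 - x) ^ (β - 1)) =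
      ENNReal.ofReal (ProbabilityTheory.beta α β) * ∫⁻ x in Ioo (0:ℝ) 1,
        ENNReal.ofReal (1 / ProbabilityTheory.beta α β * x ^ (α - 1) * (1 - x) ^ (β - 1)) := by
    rw [← lintegral_const_mul _ (by fun_prop)]
    congr 1
    funext x
    rw [← ENNReal.ofReal_mul hb.le]
    congr 1; field_simp
  rw [h2, h, mul_one]

/-- The radial integral, reduced to a beta integral by `v = r ^ (δ + 1) / ((δ + 2) c)`. -/
lemma lintegral_radial {δ κ c : ℝ} (hδ : 0 < δ) (hκ : 0 < κ) (hc : 0 < c) :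
    ∫⁻ r in {r : ℝ | 0 < r ∧ r ^ (δ + 2) / (δ + 2) - r * c < 0},
      ENNReal.ofReal r * ENNReal.ofReal ((-(r ^ (δ + 2) / (δ + 2) - r * c)) ^ (κ - 1) * r ^ δ) =
    ENNReal.ofReal ((δ + 2) / (δ + 1) * (δ + 2) ^ (κ / (δ + 1)) *
      ProbabilityTheory.beta (κ / (δ + 1) + 1) κ) * ENNReal.ofReal (c ^ (κ + κ / (δ + 1))) := by
  have ha : 0 < δ + 1 := by linarith
  have hp : 0 < δ + 2 := by linarith
  set a := δ + 1 with hadef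
  set p := δ + 2 with hpdef
  have hpc : 0 < p * c := by positivity
  set ψ : ℝ → ℝ := fun v => (p * c * v) ^ (1 / a) with hψ
  have hψpos : ∀ v, 0 < v → 0 < ψ v := fun v hv => Real.rpow_pos_of_pos (by positivity) _
  have hψa : ∀ v, 0 < v → ψ v ^ a = p * c * v := fun v hv => by
    rw [hψ]; simp only
    rw [← Real.rpow_mul (by positivity), one_div, inv_mul_cancel₀ ha.ne', Real.rpow_one]
  have hE : ∀ r : ℝ, 0 < r → r ^ p / p - r * c = r * (r ^ a / p - c) := by
    intro r hr
    rw [show p = a + 1 by rw [hadef, hpdef]; ring, Real.rpow_add hr, Real.rpow_one]; ring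
  have himage : ψ '' Ioo 0 1 = {r : ℝ | 0 < r ∧ r ^ p / p - r * c < 0} := by
    ext r
    constructor
    · rintro ⟨v, hv, rfl⟩
      refine ⟨hψpos v hv.1, ?_⟩
      rw [hE _ (hψpos v hv.1), hψa v hv.1]
      apply mul_neg_of_pos_of_neg (hψpos v hv.1)
      have : p * c * v / p - c = c * (v - 1) := by field_simp
      rw [this]
      exact mul_neg_of_pos_of_neg hc (by linarith [hv.2])
    · rintro ⟨hr, hlt⟩
      rw [hE r hr] at hlt
      have h1 : r ^ a / p - c < 0 := by
        by_contra! h; exact absurd hlt (not_lt.2 (mul_nonneg hr.le h))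
      have h2 : 0 < r ^ a := Real.rpow_pos_of_pos hr _
      refine ⟨r ^ a / (p * c), ⟨by positivity, ?_⟩, ?_⟩
      · rw [div_lt_one hpc]
        rw [sub_neg, div_lt_iff₀ hp] at h1
        linarith
      · rw [hψ]; simp only
        rw [mul_div_cancel₀ _ hpc.ne', ← Real.rpow_mul hr.le,
          mul_one_div_cancel ha.ne', Real.rpow_one]
  have hderiv : ∀ v ∈ Ioo (0:ℝ) 1, HasDerivWithinAt ψ (ψ v / (a * v)) (Ioo 0 1) v := by
    intro v hv
    have hv0 := hv.1
    have h1 : HasDerivAt (fun v : ℝ => p * c * v) (p * c * 1) v := (hasDerivAt_id' v).const_mul _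
    have h2 := h1.rpow_const (p := 1 / a) (Or.inl (by positivity))
    refine (h2.congr_deriv ?_).hasDerivWithinAt
    rw [hψ]; simp only
    rw [Real.rpow_sub_one (by positivity)]
    field_simp
  have hinj : InjOn ψ (Ioo 0 1) := by
    intro v hv w hw h
    have : ψ v ^ a = ψ w ^ a := by rw [h]
    rw [hψa v hv.1, hψa w hw.1] at this
    exact mul_left_cancel₀ hpc.ne' this
  rw [← himage, lintegral_image_eq_lintegral_abs_deriv_mul measurableSet_Ioo hderiv hinj,
    ENNReal.ofReal_mul (by positivity), ← lintegral_beta (by positivity) hκ, mul_right_comm,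
    ← ENNReal.ofReal_mul (by positivity), ← lintegral_const_mul _ (by fun_prop)]
  refine setLIntegral_congr_fun measurableSet_Ioo fun v hv => ?_
  have hv0 := hv.1
  have hv1 : 0 < 1 - v := by linarith [hv.2]
  have hr := hψpos v hv.1
  have hra := hψa v hv.1
  have hrκ : ψ v ^ κ = p ^ (κ / a) * c ^ (κ / a) * v ^ (κ / a) := by
    rw [← Real.mul_rpow hp.le hc.le, ← Real.mul_rpow hpc.le hv0.le, hψ]; simp only
    rw [← Real.rpow_mul (by positivity)]
    congr 1; ring
  have hδ1 : ψ v ^ δ = p * c * v / ψ v := by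
    rw [← hra, hadef, Real.rpow_add_one hr.ne']
    field_simp
  rw [hE _ hr, hra]
  have e1 : -(ψ v * (p * c * v / p - c)) = ψ v * (c * (1 - v)) := by field_simp; ring
  rw [e1, abs_of_pos (by positivity), ← ENNReal.ofReal_mul hr.le,
    ← ENNReal.ofReal_mul (by positivity),
    ← ENNReal.ofReal_mul (by positivity)]
  congr 1
  rw [Real.mul_rpow hr.le (by positivity), Real.mul_rpow hc.le hv1.le, Real.rpow_sub_one hr.ne',
    Real.rpow_sub_one hc.ne', hrκ, hδ1, add_sub_cancel_right, Real.rpow_add hc]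
  field_simp

/-- The substitution is `v = (1 + sin θ) / 2`, for which `v (1 - v) = (cos θ / 2) ^ 2`. -/
lemma lintegral_cos_rpow {s : ℝ} (hs : 0 < s) :
    ∫⁻ θ in Ioo (-(Real.pi / 2)) (Real.pi / 2), ENNReal.ofReal (Real.cos θ ^ s) =
      ENNReal.ofReal (2 ^ s * ProbabilityTheory.beta ((s + 1) / 2) ((s + 1) / 2)) := by
  set ψ : ℝ → ℝ := fun θ => (1 + Real.sin θ) / 2 with hψ
  have hcos : ∀ θ ∈ Ioo (-(Real.pi / 2)) (Real.pi / 2), 0 < Real.cos θ := fun θ hθ =>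
    Real.cos_pos_of_mem_Ioo hθ
  have hsin : ∀ θ ∈ Ioo (-(Real.pi / 2)) (Real.pi / 2), -1 < Real.sin θ ∧ Real.sin θ < 1 := by
    intro θ hθ
    have h1 := hcos θ hθ
    have h2 := Real.sin_sq_add_cos_sq θ
    exact abs_lt.1 ((sq_lt_one_iff_abs_lt_one _).1 (by nlinarith))
  have himage : ψ '' Ioo (-(Real.pi / 2)) (Real.pi / 2) = Ioo 0 1 := by
    ext v
    constructor
    · rintro ⟨θ, hθ, rfl⟩
      have := hsin θ hθ
      constructor <;> simp only [hψ] <;> linarith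
    · rintro ⟨h0, h1⟩
      refine ⟨Real.arcsin (2 * v - 1), ⟨Real.neg_pi_div_two_lt_arcsin.2 (by linarith),
        Real.arcsin_lt_pi_div_two.2 (by linarith)⟩, ?_⟩
      simp only [hψ]
      rw [Real.sin_arcsin (by linarith) (by linarith)]; ring
  have hderiv : ∀ θ ∈ Ioo (-(Real.pi / 2)) (Real.pi / 2), HasDerivWithinAt ψ (Real.cos θ / 2)
      (Ioo (-(Real.pi / 2)) (Real.pi / 2)) θ := fun θ _ =>
    (((Real.hasDerivAt_sin θ).const_add 1).div_const 2).hasDerivWithinAt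
  have hinj : InjOn ψ (Ioo (-(Real.pi / 2)) (Real.pi / 2)) := by
    intro x hx y hy h
    simp only [hψ] at h
    exact Real.injOn_sin (Ioo_subset_Icc_self hx) (Ioo_subset_Icc_self hy) (by linarith)
  rw [ENNReal.ofReal_mul (by positivity), ← lintegral_beta (by positivity) (by positivity),
    ← lintegral_const_mul _ (by fun_prop), ← himage,
    lintegral_image_eq_lintegral_abs_deriv_mul measurableSet_Ioo hderiv hinj]
  refine setLIntegral_congr_fun measurableSet_Ioo fun θ hθ => ?_
  have hc := hcos θ hθ
  have hs' := hsin θ hθ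
  rw [abs_of_pos (by positivity), ← ENNReal.ofReal_mul (by positivity),
    ← ENNReal.ofReal_mul (by positivity)]
  congr 1
  have e : ψ θ * (1 - ψ θ) = (Real.cos θ / 2) ^ (2:ℝ) := by
    rw [Real.rpow_two]
    simp only [hψ]; linear_combination -(1 / 4) * Real.sin_sq_add_cos_sq θ
  rw [← Real.mul_rpow (by simp only [hψ]; linarith) (by simp only [hψ]; linarith), e,
    ← Real.rpow_mul (by positivity), show (2:ℝ) * ((s + 1) / 2 - 1) = s - 1 by ring,
    Real.rpow_sub_one (by positivity), Real.div_rpow hc.le two_pos.le]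
  field_simp

/-! ### Moments of the winding -/

/-- The function `(-H) ^ (κ - 1) |z| ^ δ` on the region where the first integral
`H(z) = |z| ^ (δ + 2) / (δ + 2) - Re z` is negative, extended by `0`. -/
noncomputable def momentDensity (δ κ : ℝ) (z : ℂ) : ℝ≥0∞ :=
  if ‖z‖ ^ (δ + 2) / (δ + 2) - z.re < 0 then
    ENNReal.ofReal ((-(‖z‖ ^ (δ + 2) / (δ + 2) - z.re)) ^ (κ - 1) * ‖z‖ ^ δ) else 0

lemma measurable_momentDensity (δ κ : ℝ) : Measurable (momentDensity δ κ) := by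
  have h : Measurable fun z : ℂ => ‖z‖ ^ (δ + 2) / (δ + 2) - z.re :=
    ((measurable_norm.pow_const _).div_const _).sub Complex.measurable_re
  unfold momentDensity
  refine Measurable.ite (measurableSet_lt h measurable_const) ?_ measurable_const
  exact ((h.neg.pow_const _).mul (measurable_norm.pow_const _)).ennreal_ofReal

lemma lintegral_complex_polar {G : ℂ → ℝ≥0∞} (hG : Measurable G) :
    ∫⁻ z, G z = ∫⁻ θ in Ioo (-Real.pi) Real.pi, ∫⁻ r in Ioi (0 : ℝ),
      ENNReal.ofReal r * G (r * (Real.cos θ + Real.sin θ * Complex.I)) := by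
  rw [← Complex.lintegral_comp_polarCoord_symm, polarCoord_target, Measure.volume_eq_prod,
    ← Measure.prod_restrict]
  simp only [Complex.polarCoord_symm_apply, smul_eq_mul]
  rw [lintegral_prod_symm _ (by fun_prop)]

lemma lintegral_momentDensity {δ κ : ℝ} (hδ : 0 < δ) (hκ : 0 < κ) :
    ∫⁻ z, momentDensity δ κ z = ENNReal.ofReal ((δ + 2) / (δ + 1) * (δ + 2) ^ (κ / (δ + 1)) *
      ProbabilityTheory.beta (κ / (δ + 1) + 1) κ *
      (2 ^ (κ + κ / (δ + 1)) * ProbabilityTheory.beta ((κ + κ / (δ + 1) + 1) / 2)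
        ((κ + κ / (δ + 1) + 1) / 2))) := by
  have ha : 0 < δ + 1 := by linarith
  have hp : 0 < δ + 2 := by linarith
  set A := (δ + 2) / (δ + 1) * (δ + 2) ^ (κ / (δ + 1)) *
      ProbabilityTheory.beta (κ / (δ + 1) + 1) κ with hA
  have hA0 : 0 ≤ A := by
    have := ProbabilityTheory.beta_pos (α := κ / (δ + 1) + 1) (β := κ) (by positivity) hκ
    positivity
  rw [lintegral_complex_polar (measurable_momentDensity δ κ)]
  have hval : ∀ r θ : ℝ, 0 < r → momentDensity δ κ (r * (Real.cos θ + Real.sin θ * Complex.I)) =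
      if r ^ (δ + 2) / (δ + 2) - r * Real.cos θ < 0 then
        ENNReal.ofReal ((-(r ^ (δ + 2) / (δ + 2) - r * Real.cos θ)) ^ (κ - 1) * r ^ δ) else 0 := by
    intro r θ hr
    have h1 : ‖(r * (Real.cos θ + Real.sin θ * Complex.I) : ℂ)‖ = r := by
      rw [norm_mul, Complex.ofReal_cos, Complex.ofReal_sin, ← Complex.exp_mul_I,
        Complex.norm_exp_ofReal_mul_I, mul_one, Complex.norm_real, Real.norm_of_nonneg hr.le]
    have h2 : (r * (Real.cos θ + Real.sin θ * Complex.I) : ℂ).re = r * Real.cos θ := by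
      simp [-Complex.ofReal_sin, -Complex.ofReal_cos]
    simp only [momentDensity, h1, h2]
  have hinner : ∀ θ : ℝ, ∫⁻ r in Ioi (0 : ℝ),
      ENNReal.ofReal r * momentDensity δ κ (r * (Real.cos θ + Real.sin θ * Complex.I)) =
      (Ioi (0:ℝ)).indicator
        (fun c => ENNReal.ofReal A * ENNReal.ofReal (c ^ (κ + κ / (δ + 1)))) (Real.cos θ) := by
    intro θ
    by_cases hc : 0 < Real.cos θ
    · rw [indicator_of_mem (mem_Ioi.2 hc), ← lintegral_radial hδ hκ hc]
      have hset : {r : ℝ | 0 < r ∧ r ^ (δ + 2) / (δ + 2) - r * Real.cos θ < 0} =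
          {r : ℝ | r ^ (δ + 2) / (δ + 2) - r * Real.cos θ < 0} ∩ Ioi 0 := by
        ext r; exact and_comm
      have hms : MeasurableSet {r : ℝ | r ^ (δ + 2) / (δ + 2) - r * Real.cos θ < 0} :=
        measurableSet_lt (by fun_prop) measurable_const
      rw [hset, ← setLIntegral_indicator hms]
      refine setLIntegral_congr_fun measurableSet_Ioi fun r hr => ?_
      simp only [hval r θ hr, indicator_apply, mem_ofPred_eq, mul_ite, mul_zero]
    · rw [indicator_of_notMem (by simpa using hc)]
      rw [setLIntegral_congr_fun (g := fun _ => 0) measurableSet_Ioi fun r hr => ?_]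
      · simp
      · have hr : 0 < r := hr
        simp only
        rw [hval r θ hr, if_neg, mul_zero]
        have : 0 < r ^ (δ + 2) / (δ + 2) := by positivity
        have : r * Real.cos θ ≤ 0 := mul_nonpos_of_nonneg_of_nonpos hr.le (not_lt.1 hc)
        linarith
  simp_rw [hinner]
  have hind : ∀ θ ∈ Ioo (-Real.pi) Real.pi,
      (Ioi (0:ℝ)).indicator
        (fun c => ENNReal.ofReal A * ENNReal.ofReal (c ^ (κ + κ / (δ + 1)))) (Real.cos θ) =
      (Ioo (-(Real.pi / 2)) (Real.pi / 2)).indicator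
        (fun θ => ENNReal.ofReal A * ENNReal.ofReal (Real.cos θ ^ (κ + κ / (δ + 1)))) θ := by
    intro θ hθ
    have hiff : 0 < Real.cos θ ↔ θ ∈ Ioo (-(Real.pi / 2)) (Real.pi / 2) := by
      constructor
      · intro h
        by_contra hn
        have : Real.cos θ ≤ 0 := by
          rcases le_or_gt θ (-(Real.pi / 2)) with h1 | h1
          · rw [← Real.cos_neg]
            exact Real.cos_nonpos_of_pi_div_two_le_of_le (by linarith)
              (by linarith [hθ.1, Real.pi_pos])
          · have h2 : Real.pi / 2 ≤ θ := not_lt.1 fun h2 => hn ⟨h1, h2⟩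
            exact Real.cos_nonpos_of_pi_div_two_le_of_le h2
              (by linarith [hθ.2, Real.pi_pos])
        linarith
      · exact Real.cos_pos_of_mem_Ioo
    simp only [indicator_apply, mem_Ioi, hiff]
  rw [setLIntegral_congr_fun measurableSet_Ioo hind, setLIntegral_indicator measurableSet_Ioo,
    inter_eq_left.2 (Ioo_subset_Ioo (by linarith [Real.pi_pos]) (by linarith [Real.pi_pos])),
    lintegral_const_mul _ (by fun_prop), lintegral_cos_rpow (by positivity),
    ← ENNReal.ofReal_mul hA0]

lemma norm_one_sub_polar (ρ φ : ℝ) :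
    ‖(1 - ρ * (Real.cos φ + Real.sin φ * Complex.I) : ℂ)‖ ^ 2 = distSq ρ φ := by
  rw [Complex.sq_norm, Complex.normSq_apply]
  simp only [Complex.sub_re, Complex.sub_im, Complex.mul_re, Complex.mul_im, Complex.add_re,
    Complex.add_im, Complex.ofReal_re, Complex.ofReal_im, Complex.one_re, Complex.one_im,
    Complex.I_re, Complex.I_im]
  unfold distSq
  linear_combination ρ ^ 2 * Real.sin_sq_add_cos_sq φ

lemma norm_rpow_one_sub_polar (ρ φ : ℝ) (e : ℝ) :
    ‖(1 - ρ * (Real.cos φ + Real.sin φ * Complex.I) : ℂ)‖ ^ e = distSq ρ φ ^ (e / 2) := by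
  rw [← norm_one_sub_polar, ← Real.rpow_natCast_mul (norm_nonneg _)]
  congr 1; push_cast; ring

lemma momentDensity_one_sub_polar {δ κ : ℝ} (ρ φ : ℝ) :
    momentDensity δ κ (1 - ρ * (Real.cos φ + Real.sin φ * Complex.I)) =
      if energy δ ρ φ < 0 then
        ENNReal.ofReal ((-energy δ ρ φ) ^ (κ - 1) * freq δ ρ φ) else 0 := by
  have hre : (1 - ρ * (Real.cos φ + Real.sin φ * Complex.I) : ℂ).re = 1 - ρ * Real.cos φ := by
    simp [-Complex.ofReal_sin, -Complex.ofReal_cos]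
  have hE : ‖(1 - ρ * (Real.cos φ + Real.sin φ * Complex.I) : ℂ)‖ ^ (δ + 2) / (δ + 2) -
      (1 - ρ * (Real.cos φ + Real.sin φ * Complex.I) : ℂ).re = energy δ ρ φ := by
    rw [hre, norm_rpow_one_sub_polar, show (δ + 2) / 2 = δ / 2 + 1 by ring]
    unfold energy; ring
  unfold momentDensity
  rw [hE, norm_rpow_one_sub_polar]
  rfl

/-- Along a ray from the fixed point, the level `h` and the radius determine each other. -/
lemma lintegral_level_eq_radial {δ κ : ℝ} (hδ : 0 < δ) (φ : ℝ) :
    ∫⁻ h in Ioo 0 (depth δ), ENNReal.ofReal (h ^ (κ - 1)) *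
      ENNReal.ofReal (freq δ (radius δ h φ) φ / angularSpeed δ h φ) =
    ∫⁻ ρ in Ioi (0 : ℝ), ENNReal.ofReal ρ *
      momentDensity δ κ (1 - ρ * (Real.cos φ + Real.sin φ * Complex.I)) := by
  have hcont : Continuous fun ρ => energy δ ρ φ :=
    continuous_iff_continuousAt.2 fun ρ => (hasDerivAt_energy hδ ρ φ).continuousAt
  have hms : MeasurableSet {ρ : ℝ | energy δ ρ φ < 0} :=
    measurableSet_lt hcont.measurable measurable_const
  set S := {ρ : ℝ | energy δ ρ φ < 0} ∩ Ioi 0 with hS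
  have hrange : ∀ ρ ∈ S, -energy δ ρ φ ∈ Ioo 0 (depth δ) := by
    rintro ρ ⟨h1, h2⟩
    have h1 : energy δ ρ φ < 0 := h1
    have := strictMonoOn_energy hδ φ (mem_Ici.2 le_rfl) (Ioi_subset_Ici_self h2) h2
    simp only [energy_zero hδ] at this
    exact ⟨by linarith, by linarith⟩
  have himage : (fun ρ => -energy δ ρ φ) '' S = Ioo 0 (depth δ) := by
    ext h
    constructor
    · rintro ⟨ρ, hρ, rfl⟩
      exact hrange ρ hρ
    · intro hh
      refine ⟨radius δ h φ, ⟨?_, radius_pos δ h φ⟩, ?_⟩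
      · rw [mem_ofPred_eq, energy_radius hδ hh]; linarith [hh.1]
      · simp [energy_radius hδ hh]
  have hinj : InjOn (fun ρ => -energy δ ρ φ) S := by
    intro x hx y hy h
    exact (strictMonoOn_energy hδ φ).injOn (Ioi_subset_Ici_self hx.2) (Ioi_subset_Ici_self hy.2)
      (neg_injective h)
  have hderiv : ∀ ρ ∈ S, HasDerivWithinAt (fun ρ => -energy δ ρ φ) (-radialDeriv δ ρ φ) S ρ :=
    fun ρ _ => (hasDerivAt_energy hδ ρ φ).neg.hasDerivWithinAt
  rw [← himage,
    lintegral_image_eq_lintegral_abs_deriv_mul (hms.inter measurableSet_Ioi) hderiv hinj]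
  simp_rw [momentDensity_one_sub_polar, mul_ite, mul_zero]
  have e : ∀ ρ : ℝ, (if energy δ ρ φ < 0 then ENNReal.ofReal ρ *
      ENNReal.ofReal ((-energy δ ρ φ) ^ (κ - 1) * freq δ ρ φ) else 0) =
      {ρ : ℝ | energy δ ρ φ < 0}.indicator (fun ρ => ENNReal.ofReal ρ *
      ENNReal.ofReal ((-energy δ ρ φ) ^ (κ - 1) * freq δ ρ φ)) ρ := fun ρ => rfl
  simp_rw [e]
  rw [setLIntegral_indicator hms]
  refine setLIntegral_congr_fun (hms.inter measurableSet_Ioi) fun ρ hρ => ?_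
  have hρ0 : 0 < ρ := hρ.2
  have hD := radialDeriv_pos hδ hρ0 φ
  have hrad : radius δ (-energy δ ρ φ) φ = ρ :=
    radius_eq hδ (hrange ρ hρ) hρ0 (neg_neg _).symm
  have hlev := (hrange ρ hρ).1
  simp only [angularSpeed, hrad]
  rw [abs_neg, abs_of_pos hD, ← ENNReal.ofReal_mul (by positivity), ← ENNReal.ofReal_mul hD.le,
    ← ENNReal.ofReal_mul hρ0.le]
  congr 1
  field_simp

lemma winding_eq (δ h : ℝ) : winding δ h =
    ∫ φ in Ioc (-Real.pi) Real.pi, freq δ (radius δ h φ) φ / angularSpeed δ h φ := by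
  have hper : Function.Periodic (fun φ => freq δ (radius δ h φ) φ / angularSpeed δ h φ)
      (2 * Real.pi) := by
    intro φ
    simp only [angularSpeed_add_two_pi, radius_add_two_pi, freq, distSq, Real.cos_add_two_pi]
  have := hper.intervalIntegral_add_eq 0 (-Real.pi)
  rw [zero_add, show -Real.pi + 2 * Real.pi = Real.pi by ring] at this
  rw [winding, this, intervalIntegral.integral_of_le (by linarith [Real.pi_pos])]

lemma windingDensity_nonneg {δ : ℝ} (hδ : 0 < δ) (h φ : ℝ) :
    0 ≤ freq δ (radius δ h φ) φ / angularSpeed δ h φ :=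
  div_nonneg (freq_nonneg _ _ _) (angularSpeed_pos hδ h φ).le

lemma winding_nonneg {δ : ℝ} (hδ : 0 < δ) (h : ℝ) : 0 ≤ winding δ h := by
  rw [winding_eq]
  exact integral_nonneg fun φ => windingDensity_nonneg hδ h φ

/-- The moments of the winding as an integral over the plane. -/
lemma lintegral_winding_eq {δ κ : ℝ} (hδ : 0 < δ) :
    ∫⁻ h in Ioo 0 (depth δ), ENNReal.ofReal (h ^ (κ - 1)) * ENNReal.ofReal (winding δ h) =
      ∫⁻ z, momentDensity δ κ z := by
  have h1 : ∀ h ∈ Ioo 0 (depth δ), ENNReal.ofReal (h ^ (κ - 1)) * ENNReal.ofReal (winding δ h) =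
      ∫⁻ φ in Ioo (-Real.pi) Real.pi, ENNReal.ofReal (h ^ (κ - 1)) *
        ENNReal.ofReal (freq δ (radius δ h φ) φ / angularSpeed δ h φ) := by
    intro h hh
    have hcont := continuous_windingDensity hδ hh
    rw [winding_eq, ofReal_integral_eq_lintegral_ofReal hcont.integrableOn_Ioc
      (Filter.Eventually.of_forall fun φ => windingDensity_nonneg hδ h φ),
      setLIntegral_congr Ioo_ae_eq_Ioc.symm, lintegral_const_mul _ hcont.measurable.ennreal_ofReal]
  rw [setLIntegral_congr_fun measurableSet_Ioo h1]
  have hmeas : AEMeasurable (Function.uncurry fun h φ : ℝ => ENNReal.ofReal (h ^ (κ - 1)) *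
      ENNReal.ofReal (freq δ (radius δ h φ) φ / angularSpeed δ h φ))
      ((volume.restrict (Ioo 0 (depth δ))).prod (volume.restrict (Ioo (-Real.pi) Real.pi))) := by
    rw [Measure.prod_restrict]
    have h2 : AEMeasurable (fun q : ℝ × ℝ => freq δ (radius δ q.1 q.2) q.2 / angularSpeed δ q.1 q.2)
        ((volume.prod volume).restrict (Ioo 0 (depth δ) ×ˢ Ioo (-Real.pi) Real.pi)) :=
      ((continuousOn_windingDensity hδ).mono (prod_mono_right (subset_univ _))).aemeasurable
        (measurableSet_Ioo.prod measurableSet_Ioo)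
    exact (by fun_prop : Measurable fun q : ℝ × ℝ =>
      ENNReal.ofReal (q.1 ^ (κ - 1))).aemeasurable.mul h2.ennreal_ofReal
  rw [lintegral_lintegral_swap hmeas]
  simp_rw [lintegral_level_eq_radial hδ]
  rw [← lintegral_complex_polar (G := fun w => momentDensity δ κ (1 - w))
    ((measurable_momentDensity δ κ).comp (by fun_prop)), lintegral_sub_left_eq_self]

/-- The moments of the winding are those of a compound Poisson law. -/
theorem lintegral_winding {δ κ : ℝ} (hδ : 0 < δ) (hκ : 0 < κ) :
    ∫⁻ h in Ioo 0 (depth δ), ENNReal.ofReal (h ^ (κ - 1)) * ENNReal.ofReal (winding δ h) =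
      ENNReal.ofReal (2 * Real.pi / √(δ + 1) * (depth δ ^ κ / κ) *
        Real.exp (∫ t in Ioi (0 : ℝ), Real.exp (-(κ * t)) * jumpDensity (δ + 1) t)) := by
  rw [lintegral_winding_eq hδ, lintegral_momentDensity hδ hκ]
  congr 1
  have ha : 0 < δ + 1 := by linarith
  have hG := Gamma_quotient ha hκ
  rw [depth, show δ + 2 = δ + 1 + 1 by ring]
  set a := δ + 1
  set m := (1 + 1 / a) / 2 with hm
  have hm0 : 0 < m := by positivity
  have hma : 2 * m * a = a + 1 := by rw [hm]; field_simp
  set E := Real.exp (∫ t in Ioi (0 : ℝ), Real.exp (-(κ * t)) * jumpDensity a t)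
  set y := κ * m with hy
  have hy0 : 0 < y := by positivity
  have hs : κ + κ / a = 2 * y := by rw [hy, hm]; field_simp
  rw [hs]
  have e1 : κ / a + 1 + κ = 2 * y + 1 := by linarith
  have e2 : (2 * y + 1) / 2 = y + 1 / 2 := by ring
  have e3 : y + 1 / 2 + (y + 1 / 2) = 2 * y + 1 := by ring
  have hdup := Real.Gamma_mul_Gamma_add_half y
  have h2y : Real.Gamma (2 * y) =
      Real.Gamma y * Real.Gamma (y + 1 / 2) * 2 ^ (2 * y - 1) / √Real.pi := by
    rw [hdup, show 1 - 2 * y = -(2 * y - 1) by ring, Real.rpow_neg two_pos.le]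
    have : (0:ℝ) < 2 ^ (2 * y - 1) := by positivity
    have := Real.sqrt_pos.2 Real.pi_pos
    field_simp
  unfold ProbabilityTheory.beta
  rw [e1, e2, e3, Real.Gamma_add_one (by positivity), Real.Gamma_add_one (by positivity), h2y,
    Real.rpow_sub_one two_ne_zero]
  have h4 : (4:ℝ) ^ (-y) = 1 / 2 ^ (2 * y) := by
    rw [Real.rpow_neg (by norm_num), Real.rpow_mul two_pos.le]; norm_num
  rw [h4] at hG
  have hsa : √a ^ 2 = a := Real.sq_sqrt ha.le
  have hsπ : √Real.pi ^ 2 = Real.pi := Real.sq_sqrt Real.pi_pos.le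
  have hsa0 := Real.sqrt_pos.2 ha
  have hsπ0 := Real.sqrt_pos.2 Real.pi_pos
  have g1 := Real.Gamma_pos_of_pos hy0
  have g2 := Real.Gamma_pos_of_pos (show 0 < y + 1 / 2 by positivity)
  have g3 := Real.Gamma_pos_of_pos hκ
  have g4 := Real.Gamma_pos_of_pos (show 0 < κ / a by positivity)
  have p1 : (0:ℝ) < 2 ^ (2 * y) := by positivity
  have p2 : 0 < (a + 1) ^ (κ / a) := by positivity
  calc _ = (a + 1) / a ^ 2 * (Real.pi / (κ * m ^ 2)) * ((a + 1) ^ (κ / a) * (1 / 2 ^ (2 * y)) *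
      (Real.Gamma (κ / a) * Real.Gamma κ / Real.Gamma y ^ 2)) := by
        rw [hy]; field_simp; rw [hsπ]
    _ = _ := by
        rw [hG, ← hma]
        field_simp
        rw [hsa]

/-- The winding is a strictly decreasing function of the level. -/
theorem strictAntiOn_winding {δ : ℝ} (hδ : 0 < δ) : StrictAntiOn (winding δ) (Ioo 0 (depth δ)) := by
  have hd : 0 < depth δ := by unfold depth; positivity
  exact strictAntiOn_of_moments hd (C := 2 * Real.pi / √(δ + 1))
    (by have := Real.pi_pos; positivity)
    (continuousOn_winding hδ) (fun h _ => winding_nonneg hδ h) (measurable_jumpDensity (δ + 1))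
    (fun t ht => jumpDensity_pos (by linarith) ht)
    (fun κ hκ => integrableOn_jumpDensity (by linarith) hκ) (fun κ hκ => lintegral_winding hδ hκ)

/-! ### Levels of the points of the real axis -/

/-- Minus the value of the first integral at the point `s` of the real axis. -/
noncomputable def level (δ s : ℝ) : ℝ := s - s ^ (δ + 2) / (δ + 2)

lemma strictMonoOn_level {δ : ℝ} (hδ : 0 < δ) : StrictMonoOn (level δ) (Icc 0 1) := by
  have hd : ∀ s : ℝ, HasDerivAt (level δ) (1 - s ^ (δ + 1)) s := by
    intro s
    have h := (hasDerivAt_id' s).sub (((hasDerivAt_id' s).rpow_const (p := δ + 2)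
      (Or.inr (by linarith))).div_const (δ + 2))
    refine h.congr_deriv ?_
    rw [show δ + 2 - 1 = δ + 1 by ring]
    field_simp
  apply strictMonoOn_of_deriv_pos (convex_Icc 0 1)
    fun s _ => (hd s).continuousAt.continuousWithinAt
  intro s hs
  rw [interior_Icc] at hs
  rw [(hd s).deriv, sub_pos]
  exact Real.rpow_lt_one hs.1.le hs.2 (by linarith)

lemma level_mem_Ioo {δ : ℝ} (hδ : 0 < δ) {s : ℝ} (hs : s ∈ Ioo (0:ℝ) 1) :
    level δ s ∈ Ioo 0 (depth δ) := by
  have h0 := strictMonoOn_level hδ (left_mem_Icc.2 zero_le_one) (Ioo_subset_Icc_self hs) hs.1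
  have h1 := strictMonoOn_level hδ (Ioo_subset_Icc_self hs) (right_mem_Icc.2 zero_le_one) hs.2
  have e0 : level δ 0 = 0 := by simp [level, Real.zero_rpow (by linarith : δ + 2 ≠ 0)]
  have e1 : level δ 1 = depth δ := by
    simp only [level, depth, Real.one_rpow]; field_simp; ring
  rw [e0] at h0; rw [e1] at h1
  exact ⟨h0, h1⟩

lemma energy_eq_norm (δ ρ φ : ℝ) :
    ‖(1 - ρ * Complex.exp (φ * Complex.I) : ℂ)‖ ^ (δ + 2) / (δ + 2) -
      (1 - ρ * Complex.exp (φ * Complex.I) : ℂ).re = energy δ ρ φ := by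
  have hre : (1 - ρ * Complex.exp (φ * Complex.I) : ℂ).re = 1 - ρ * Real.cos φ := by
    rw [Complex.sub_re, Complex.re_ofReal_mul, Complex.exp_ofReal_mul_I_re, Complex.one_re]
  rw [hre, Complex.exp_mul_I, ← Complex.ofReal_cos, ← Complex.ofReal_sin, norm_rpow_one_sub_polar,
    show (δ + 2) / 2 = δ / 2 + 1 by ring]
  unfold energy; ring

lemma freq_eq_norm (δ ρ φ : ℝ) :
    monomial δ ‖(1 - ρ * Complex.exp (φ * Complex.I) : ℂ)‖ = freq δ ρ φ := by
  rw [monomial, Complex.exp_mul_I, ← Complex.ofReal_cos, ← Complex.ofReal_sin,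
    norm_rpow_one_sub_polar]
  rfl

lemma radius_level_zero {δ : ℝ} (hδ : 0 < δ) {s : ℝ} (hs : s ∈ Ioo (0:ℝ) 1) :
    radius δ (level δ s) 0 = 1 - s := by
  apply radius_eq hδ (level_mem_Ioo hδ hs) (by linarith [hs.2])
  rw [← energy_eq_norm]
  have : (1 - ((1 - s : ℝ) : ℂ) * Complex.exp ((0:ℝ) * Complex.I)) = (s : ℂ) := by simp
  rw [this, Complex.norm_real, Real.norm_of_nonneg hs.1.le, Complex.ofReal_re]
  unfold level; ring

/-! ### Existence of trajectories -/

/-- The time needed to reach the angle `φ` about the fixed point, along the level curve `-h`. -/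
noncomputable def timeOfAngle (δ h φ : ℝ) : ℝ := ∫ x in (0 : ℝ)..φ, (angularSpeed δ h x)⁻¹

lemma continuous_angularSpeed_inv {δ : ℝ} (hδ : 0 < δ) {h : ℝ} (hh : h ∈ Ioo 0 (depth δ)) :
    Continuous fun x => (angularSpeed δ h x)⁻¹ :=
  (continuous_angularSpeed hδ hh).inv₀ fun x => (angularSpeed_pos hδ h x).ne'

lemma hasDerivAt_timeOfAngle {δ : ℝ} (hδ : 0 < δ) {h : ℝ} (hh : h ∈ Ioo 0 (depth δ)) (φ : ℝ) :
    HasDerivAt (timeOfAngle δ h) (angularSpeed δ h φ)⁻¹ φ :=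
  (continuous_angularSpeed_inv hδ hh).integral_hasStrictDerivAt 0 φ |>.hasDerivAt

lemma strictMono_timeOfAngle {δ : ℝ} (hδ : 0 < δ) {h : ℝ} (hh : h ∈ Ioo 0 (depth δ)) :
    StrictMono (timeOfAngle δ h) := by
  apply strictMono_of_deriv_pos
  intro φ
  rw [(hasDerivAt_timeOfAngle hδ hh φ).deriv]
  exact inv_pos.2 (angularSpeed_pos hδ h φ)

lemma timeOfAngle_zero (δ h : ℝ) : timeOfAngle δ h 0 = 0 := by simp [timeOfAngle]

/-- The angular speed is periodic in the angle, so that each revolution takes the same time. -/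
lemma surjective_timeOfAngle {δ : ℝ} (hδ : 0 < δ) {h : ℝ} (hh : h ∈ Ioo 0 (depth δ)) :
    Function.Surjective (timeOfAngle δ h) := by
  have hper : Function.Periodic (fun x => (angularSpeed δ h x)⁻¹) (2 * Real.pi) := fun x => by
    simp only [angularSpeed_add_two_pi]
  have hint := fun a b => (continuous_angularSpeed_inv hδ hh).intervalIntegrable (μ := volume) a b
  have hpos : ∀ x, 0 < (angularSpeed δ h x)⁻¹ := fun x => inv_pos.2 (angularSpeed_pos hδ h x)
  have h2 : 0 < 2 * Real.pi := by have := Real.pi_pos; linarith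
  have h1 : Continuous (timeOfAngle δ h) :=
    continuous_iff_continuousAt.2 fun φ => (hasDerivAt_timeOfAngle hδ hh φ).continuousAt
  exact h1.surjective
    (hper.tendsto_atTop_intervalIntegral_of_pos' (hint 0 _) hpos h2)
    (hper.tendsto_atBot_intervalIntegral_of_pos' (hint 0 _) hpos h2)

/-- The trajectory follows the level curve, with the angle about the fixed point given by the
inverse of `timeOfAngle`. -/
lemma exists_isTrajectory {δ : ℝ} (hδ : 0 < δ) {s : ℝ} (hs : s ∈ Ioo (0:ℝ) 1) :
    ∃ γ, IsTrajectory (monomial δ) (s : ℂ) γ := by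
  have hh := level_mem_Ioo hδ hs
  set h := level δ s with hhdef
  let e : ℝ ≃o ℝ := StrictMono.orderIsoOfSurjective _ (strictMono_timeOfAngle hδ hh)
    (surjective_timeOfAngle hδ hh)
  have heθ : ∀ t, timeOfAngle δ h (e.symm t) = t := fun t => e.apply_symm_apply t
  have he0 : e.symm 0 = 0 := by
    apply (strictMono_timeOfAngle hδ hh).injective
    rw [heθ, timeOfAngle_zero]
  have hde : ∀ t, HasDerivAt (fun t => e.symm t) (angularSpeed δ h (e.symm t)) t := by
    intro t
    have := HasDerivAt.of_local_left_inverse (f := timeOfAngle δ h) (g := fun t => e.symm t)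
      (a := t)
      e.symm.continuous.continuousAt (hasDerivAt_timeOfAngle hδ hh (e.symm t))
      (inv_ne_zero (angularSpeed_pos hδ h _).ne') (Filter.Eventually.of_forall heθ)
    rwa [inv_inv] at this
  refine ⟨fun t => 1 - radius δ h (e.symm t) * Complex.exp ((e.symm t : ℝ) * Complex.I), ?_, ?_, ?_⟩
  · simp only [he0]
    rw [hhdef, radius_level_zero hδ hs]; simp
  · intro t h0
    have := energy_eq_norm δ (radius δ h (e.symm t)) (e.symm t)
    rw [h0, energy_radius hδ hh, norm_zero, Real.zero_rpow (by linarith), Complex.zero_re,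
      zero_div, sub_zero] at this
    linarith [hh.1]
  · intro t
    simp only [freq_eq_norm]
    set x := e.symm t with hx
    set r := radius δ h x with hr
    set F := freq δ r x with hF
    have hr0 : 0 < r := radius_pos δ h x
    have hD : 0 < radialDeriv δ r x := radialDeriv_pos hδ hr0 x
    have h1 : HasDerivAt (fun t => radius δ h (e.symm t)) ((1 - F) * Real.sin x) t := by
      refine ((hasDerivAt_radius hδ hh x).comp t (hde t)).congr_deriv ?_
      rw [← hx, ← hr, ← hF, angularSpeed, ← hr]
      field_simp
    have h2 : HasDerivAt (fun t => Complex.exp ((e.symm t : ℝ) * Complex.I))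
        (Complex.exp (x * Complex.I) * ((angularSpeed δ h x : ℝ) * Complex.I)) t :=
      ((hde t).ofReal_comp.mul_const Complex.I).cexp
    refine ((h1.ofReal_comp.mul h2).const_sub 1).congr_deriv ?_
    have hΩ : (r : ℂ) * (angularSpeed δ h x : ℝ) = F * (r - Real.cos x) + Real.cos x := by
      have : r * angularSpeed δ h x = F * (r - Real.cos x) + Real.cos x := by
        rw [angularSpeed, ← hr, mul_div_cancel₀ _ hr0.ne']; rfl
      exact_mod_cast this
    rw [← hx, ← hr]
    rw [show (r : ℂ) * (Complex.exp (x * Complex.I) * ((angularSpeed δ h x : ℝ) * Complex.I)) =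
      (r * (angularSpeed δ h x : ℝ)) * (Complex.exp (x * Complex.I) * Complex.I) by ring, hΩ]
    rw [Complex.exp_mul_I]
    push_cast
    have hsc := Complex.sin_sq_add_cos_sq (x : ℂ)
    have hI := Complex.I_sq
    generalize Complex.cos (x : ℂ) = c at *
    generalize Complex.sin (x : ℂ) = d at *
    linear_combination (-(1 - F) * Complex.I) * hsc + (-(1-F) * c * d) * hI

/-! ### Period, orientation and winding of a trajectory -/

/-- The first integral is conserved along trajectories. -/
lemma IsTrajectory.energy_const {δ : ℝ} (hδ : 0 < δ) {p : ℂ} {γ : ℝ → ℂ}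
    (hγ : IsTrajectory (monomial δ) p γ) (t : ℝ) :
    ‖γ t‖ ^ (δ + 2) / (δ + 2) - (γ t).re = ‖p‖ ^ (δ + 2) / (δ + 2) - p.re := by
  have hsq : ∀ (z : ℂ) (q : ℝ), ‖z‖ ^ q = (z.re ^ 2 + z.im ^ 2) ^ (q / 2) := by
    intro z q
    have : z.re ^ 2 + z.im ^ 2 = ‖z‖ ^ 2 := by rw [Complex.sq_norm, Complex.normSq_apply]; ring
    rw [this, ← Real.rpow_natCast_mul (norm_nonneg _)]
    congr 1; push_cast; ring
  have hd : ∀ t, HasDerivAt (fun t => ‖γ t‖ ^ (δ + 2) / (δ + 2) - (γ t).re) 0 t := by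
    intro t
    have hre := Complex.reCLM.hasFDerivAt.comp_hasDerivAt t (hγ.hasDerivAt t)
    have him := Complex.imCLM.hasFDerivAt.comp_hasDerivAt t (hγ.hasDerivAt t)
    simp only [Function.comp_def, Complex.reCLM_apply, Complex.imCLM_apply] at hre him
    have h1 := ((((hre.fun_pow 2).fun_add (him.fun_pow 2)).rpow_const (p := (δ + 2) / 2)
      (Or.inr (by linarith))).div_const (δ + 2)).fun_sub hre
    simp only [hsq]
    refine h1.congr_deriv ?_
    simp only [monomial, hsq, Complex.sub_re, Complex.sub_im, Complex.mul_re, Complex.mul_im,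
      Complex.I_re, Complex.I_im, Complex.ofReal_re, Complex.ofReal_im]
    rw [show (δ + 2) / 2 - 1 = δ / 2 by ring]
    field_simp
    ring
  have := is_const_of_deriv_eq_zero (fun t => (hd t).differentiableAt) (fun t => (hd t).deriv) t 0
  simp only [hγ.init] at this
  exact this

/-- A trajectory through a point of `]0, 1[` runs counter-clockwise along a level curve of the first
integral, and `timeOfAngle` computes its period. -/
theorem IsTrajectory.exists_period {δ : ℝ} (hδ : 0 < δ) {s : ℝ} (hs : s ∈ Ioo (0:ℝ) 1) {γ : ℝ → ℂ}
    (hγ : IsTrajectory (monomial δ) (s : ℂ) γ) :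
    ∃ T, 0 < T ∧ γ T = s ∧ (∀ t, 0 < t → γ t = s → T ≤ t) ∧ IsCounterclockwise γ T ∧
      ∫ t in (0 : ℝ)..T, monomial δ ‖γ t‖ = winding δ (level δ s) := by
  have hh := level_mem_Ioo hδ hs
  have hen : ∀ t, ‖γ t‖ ^ (δ + 2) / (δ + 2) - (γ t).re = -level δ s := by
    intro t
    rw [hγ.energy_const hδ, Complex.norm_real, Real.norm_of_nonneg hs.1.le, Complex.ofReal_re,
      level]
    ring
  set h := level δ s with hhdef
  have hne : ∀ t, γ t - 1 ≠ 0 := by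
    intro t h1
    have := hen t
    rw [sub_eq_zero.1 h1, norm_one, Real.one_rpow, Complex.one_re] at this
    have h3 : 1 / (δ + 2) - 1 = -depth δ := by unfold depth; field_simp; ring
    linarith [hh.2]
  have hcont : Continuous γ := continuous_iff_continuousAt.2 fun t => (hγ.hasDerivAt t).continuousAt
  have hcontf : Continuous fun t => monomial δ ‖γ t‖ := by
    unfold monomial
    exact hcont.norm.rpow_const fun _ => Or.inr hδ.le
  -- the logarithmic derivative about the fixed point, and its primitive
  set q : ℝ → ℂ := fun t =>
    (Complex.I * γ t * ((monomial δ ‖γ t‖ : ℝ) : ℂ) - Complex.I) / (γ t - 1) with hq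
  have hqc : Continuous q := by
    refine Continuous.div ?_ (by fun_prop) hne
    exact ((continuous_const.mul hcont).mul
      (Complex.continuous_ofReal.comp hcontf)).sub continuous_const
  set L : ℝ → ℂ := fun t => ∫ x in (0 : ℝ)..t, q x with hL
  have hLd : ∀ t, HasDerivAt L (q t) t := fun t => (hqc.integral_hasStrictDerivAt 0 t).hasDerivAt
  have hL0 : L 0 = 0 := by simp [hL]
  have hexp : ∀ t, γ t - 1 = (s - 1) * Complex.exp (L t) := by
    have hd : ∀ t, HasDerivAt (fun t => (γ t - 1) * Complex.exp (-L t)) 0 t := by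
      intro t
      refine (((hγ.hasDerivAt t).sub_const 1).fun_mul (hLd t).neg.cexp).congr_deriv ?_
      simp only [hq, Pi.neg_apply]
      field_simp [hne t]
      ring
    intro t
    have := is_const_of_deriv_eq_zero (fun t => (hd t).differentiableAt) (fun t => (hd t).deriv) t 0
    simp only [hL0, neg_zero, Complex.exp_zero, mul_one, hγ.init] at this
    rw [← this, mul_assoc, ← Complex.exp_add]; simp
  -- polar coordinates of `1 - γ t`, with a continuous choice of the angle
  set φ : ℝ → ℝ := fun t => (L t).im with hφ
  set ρ : ℝ → ℝ := fun t => (1 - s) * Real.exp (L t).re with hρ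
  have hρ0 : ∀ t, 0 < ρ t := fun t => mul_pos (by linarith [hs.2]) (Real.exp_pos _)
  have hγpolar : ∀ t, γ t = 1 - ρ t * Complex.exp (φ t * Complex.I) := by
    intro t
    have e1 : Complex.exp (L t) =
        Complex.exp ((L t).re : ℂ) * Complex.exp ((L t).im * Complex.I) := by
      rw [← Complex.exp_add, Complex.re_add_im]
    have := hexp t
    rw [e1] at this
    simp only [hρ, hφ]
    push_cast
    linear_combination this
  have hrad : ∀ t, radius δ h (φ t) = ρ t := by
    intro t
    apply radius_eq hδ hh (hρ0 t)
    rw [← energy_eq_norm, ← hγpolar, hen]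
  have hfreq : ∀ t, monomial δ ‖γ t‖ = freq δ (ρ t) (φ t) := by
    intro t
    rw [hγpolar, freq_eq_norm]
  have hφd : ∀ t, HasDerivAt φ (angularSpeed δ h (φ t)) t := by
    intro t
    have him := Complex.imCLM.hasFDerivAt.comp_hasDerivAt t (hLd t)
    refine him.congr_deriv ?_
    rw [Complex.imCLM_apply, angularSpeed, hrad]
    simp only [hq]
    rw [hfreq, hγpolar]
    have hρt := hρ0 t
    have hρc : (ρ t : ℂ) ≠ 0 := by exact_mod_cast hρt.ne'
    have hE := Complex.exp_ne_zero ((φ t : ℝ) * Complex.I)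
    have e2 : (Complex.I * (1 - ρ t * Complex.exp (φ t * Complex.I)) *
        ((freq δ (ρ t) (φ t) : ℝ) : ℂ) - Complex.I) /
          (1 - ρ t * Complex.exp (φ t * Complex.I) - 1) =
        (freq δ (ρ t) (φ t) : ℝ) * Complex.I +
          (((1 - freq δ (ρ t) (φ t)) / ρ t : ℝ) : ℂ) *
            (Complex.I * Complex.exp ((-φ t : ℝ) * Complex.I)) := by
      rw [Complex.ofReal_neg, neg_mul, Complex.exp_neg]
      push_cast
      field_simp
      ring
    rw [e2, Complex.add_im, Complex.im_ofReal_mul, Complex.im_ofReal_mul, Complex.I_im,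
      Complex.I_mul_im, Complex.exp_ofReal_mul_I_re, Real.cos_neg, radialDeriv]
    field_simp
    ring
  have htime : ∀ t, timeOfAngle δ h (φ t) = t := by
    have hd : ∀ t, HasDerivAt (fun t => timeOfAngle δ h (φ t) - t) 0 t := by
      intro t
      refine (((hasDerivAt_timeOfAngle hδ hh (φ t)).comp t (hφd t)).sub
        (hasDerivAt_id' t)).congr_deriv ?_
      rw [inv_mul_cancel₀ (angularSpeed_pos hδ h _).ne', sub_self]
    intro t
    have := is_const_of_deriv_eq_zero (fun t => (hd t).differentiableAt) (fun t => (hd t).deriv) t 0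
    simp only [hφ, hL0, Complex.zero_im, timeOfAngle_zero] at this
    linarith
  have hmono := strictMono_timeOfAngle hδ hh
  set T := timeOfAngle δ h (2 * Real.pi) with hT
  have hφT : φ T = 2 * Real.pi := hmono.injective (htime T)
  have hφ0 : φ 0 = 0 := by simp [hφ, hL0]
  have hT0 : 0 < T := by
    rw [← timeOfAngle_zero δ h]; exact hmono (by have := Real.pi_pos; positivity)
  have hR0 : radius δ h 0 = 1 - s := radius_level_zero hδ hs
  refine ⟨T, hT0, ?_, ?_, ?_, ?_⟩
  · have : ρ T = 1 - s := by
      have h2 := radius_add_two_pi δ h 0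
      rw [← hrad, hφT, ← hR0, ← h2, zero_add]
    rw [hγpolar, hφT, this]
    push_cast
    rw [Complex.exp_two_pi_mul_I]; ring
  · intro t ht hγt
    have hφt : 0 < φ t := by
      rw [← hmono.lt_iff_lt, htime, timeOfAngle_zero]; exact ht
    have h1 : (ρ t : ℂ) * Complex.exp (φ t * Complex.I) = ((1 - s : ℝ) : ℂ) := by
      have := hγpolar t
      rw [hγt] at this
      push_cast
      linear_combination this
    have h2 : ρ t = 1 - s := by
      have := congrArg norm h1
      rwa [norm_mul, Complex.norm_exp_ofReal_mul_I, mul_one, Complex.norm_real, Complex.norm_real,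
        Real.norm_of_nonneg (hρ0 t).le, Real.norm_of_nonneg (by linarith [hs.2])] at this
    have h3 : Complex.exp (φ t * Complex.I) = 1 := by
      rw [← h2] at h1
      exact mul_left_cancel₀ (by exact_mod_cast (hρ0 t).ne') (h1.trans (mul_one _).symm)
    obtain ⟨n, hn⟩ := Complex.exp_eq_one_iff.1 h3
    have h4 : φ t = n * (2 * Real.pi) := by
      have : (φ t : ℂ) = ((n * (2 * Real.pi) : ℝ) : ℂ) := by
        push_cast
        refine mul_right_cancel₀ Complex.I_ne_zero (hn.trans ?_)
        ring
      exact_mod_cast this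
    have hn0 : 0 < n := by
      by_contra! hle
      have : (n : ℝ) ≤ 0 := by exact_mod_cast hle
      rw [h4] at hφt
      nlinarith [Real.pi_pos]
    have hn1 : (1 : ℝ) ≤ n := by exact_mod_cast hn0
    rw [← htime t]
    apply hmono.monotone
    rw [h4]
    nlinarith [Real.pi_pos]
  · refine ⟨1, ?_, ?_⟩
    · rintro ⟨t, ht⟩
      exact hne t (sub_eq_zero.2 ht)
    · have e1 : ∫ t in (0 : ℝ)..T, deriv γ t / (γ t - 1) = L T := by
        simp only [hL, hq, (hγ.hasDerivAt _).deriv]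
      rw [windingNumber, e1]
      have e2 : (2 * (Real.pi : ℂ) * Complex.I)⁻¹ * L T =
          (((2 * Real.pi)⁻¹ : ℝ) : ℂ) * (-Complex.I * L T) := by
        push_cast
        rw [mul_inv, Complex.inv_I]; ring
      rw [e2, Complex.re_ofReal_mul, neg_mul, Complex.neg_re, Complex.I_mul_re, neg_neg]
      change 0 < (2 * Real.pi)⁻¹ * φ T
      rw [hφT]
      have := Real.pi_pos
      positivity
  · have e1 : ∀ t, monomial δ ‖γ t‖ =
        ((fun x => freq δ (radius δ h x) x / angularSpeed δ h x) ∘ φ) t *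
          angularSpeed δ h (φ t) := by
      intro t
      have := (angularSpeed_pos hδ h (φ t)).ne'
      rw [hfreq]
      simp only [Function.comp_apply, hrad]
      field_simp
    simp_rw [e1]
    have hφc : Continuous φ := continuous_iff_continuousAt.2 fun t => (hφd t).continuousAt
    rw [intervalIntegral.integral_comp_mul_deriv (fun t _ => hφd t)
      ((continuous_angularSpeed hδ hh).comp hφc).continuousOn (continuous_windingDensity hδ hh),
      hφT, hφ0, winding]

lemma netWinding_monomial {δ : ℝ} (hδ : 0 < δ) {s : ℝ} (hs : s ∈ Ioo (0:ℝ) 1) :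
    netWinding (monomial δ) (s : ℂ) = (2 * Real.pi)⁻¹ * winding δ (level δ s) := by
  have hex := exists_isTrajectory hδ hs
  have htr : IsTrajectory (monomial δ) (s : ℂ) (trajectory (monomial δ) (s : ℂ)) := by
    unfold trajectory
    rw [dif_pos hex]
    exact hex.choose_spec
  obtain ⟨T, hT, hTs, hmin, hcc, hint⟩ := htr.exists_period hδ hs
  have hper : minPeriod (monomial δ) (s : ℂ) = T :=
    IsLeast.csInf_eq ⟨⟨hT, hTs⟩, fun t ht => hmin t ht.1 ht.2⟩
  rw [netWinding, hper, orientationSign, if_pos hcc, hint, one_mul]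

end NetWinding

theorem mainTheorem2 (δ : ℝ) (hδ : 3 / 2 ≤ δ) :
    (∀ s ∈ Set.Ioo (0 : ℝ) 1, NetWinding.IsPeriodicPoint (NetWinding.monomial δ) (s : ℂ)) ∧
      StrictAntiOn (fun s : ℝ => NetWinding.netWinding (NetWinding.monomial δ) (s : ℂ))
        (Set.Ioo (0 : ℝ) 1) := by
  have hδ0 : 0 < δ := by linarith
  refine ⟨fun s hs => ?_, fun s hs s' hs' hlt => ?_⟩
  · obtain ⟨γ, hγ⟩ := NetWinding.exists_isTrajectory hδ0 hs
    obtain ⟨T, hT, hTs, -⟩ := hγ.exists_period hδ0 hs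
    exact ⟨γ, hγ, T, hT, hTs⟩
  · have hlev := NetWinding.strictMonoOn_level hδ0 (Set.Ioo_subset_Icc_self hs)
      (Set.Ioo_subset_Icc_self hs') hlt
    have hwind := NetWinding.strictAntiOn_winding hδ0 (NetWinding.level_mem_Ioo hδ0 hs)
      (NetWinding.level_mem_Ioo hδ0 hs') hlev
    simp only [NetWinding.netWinding_monomial hδ0 hs, NetWinding.netWinding_monomial hδ0 hs']
    have := Real.pi_pos
    gcongr
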